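/- **Setting.** Let $\mu$ be a $\sigma$-finite measure on a measurable space $\mathcal Y$ (the counting measure for discrete data), and let $y_1,y_2,\dots$ be i.i.d. with a strictly positive density $q$ with respect to $\mu$. Write $y^{(n)}=(y_1,\dots,y_n)$ and $q^n(y^{(n)})=\prod_{i\le n} q(y_i)$. Expectations $E_q$ and variances $\mathrm{Var}_q$ are taken under $q$. Densities that are equal $\mu$-almost everywhere are identified. *Regular model.* A nonsingleton model $\mathcal M=\{f^n(\cdot\mid\xi):\xi\in\Xi\}$, with $f^n(y^{(n)}\mid\xi)=\prod_{i\le n}f(y_i\mid\xi)$, is called regular with respect to $q$ if: 1. $\Xi\subseteq\mathbb R^d$ is open; 2. each $f(\cdot\mid\xi)$, $\xi\in\Xi$, is a strictly positive density with respect to $\mu$; 3. there is a unique $\xi^\star\in\Xi$ at which $K_q(\xi)=E_q\log\{q(y_1)/f(y_1\mid\xi)\}$ attains its infimum $K^\star$ over $\Xi$, the Kullback–Leibler divergence from $q$ to $\mathcal M$; 4. $\mathrm{Var}_q\log\{q(y_1)/f(y_1\mid\xi^\star)\}<\infty$; 5. for every $y\in\mathcal Y$, $\ell(y\mid\cdot)=\log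 f(y\mid\cdot)$ is twice continuously differentiable on $\Xi$, with gradient $s(y\mid\cdot)$ and Hessian $H(y\mid\cdot)$; 6. $E_q|\ell(y_1\mid\xi^\star)|<\infty$ and $E_q\|s(y_1\mid\xi^\star)\|_2^2<\infty$; 7. there are a ball $B\subseteq\Xi$ centred at $\xi^\star$ and a function $c\ge0$ with $E_q c(y_1)<\infty$ such that $\sup_{\xi\in B}\|H(y\mid\xi)\|_\infty\le c(y)$ for all $y\in\mathcal Y$; 8. for all $n\ge1$, $y^{(n)}\in\mathcal Y^n$ and $\lambda\in\mathbb R$, the set $\{\xi\in\Xi: n^{-1}\sum_{i\le n}\ell(y_i\mid\xi)>\lambda\}$ is connected (possibly empty); 9. the Hessian matrix $-E_q H(y_1\mid\xi^\star)$ of $K_q$ at $\xi^\star$ is positive definite. A singleton model $\{f^n(\cdot\mid\xi^\star)\}$ is called regular if 2 and 4 hold and $K^\star=K_q(\xi^\star)<\infty$. *Regular generalized moment prior.* This is a density $p^M=gp/C_g$ on the open set $\Xi$, where $p$ is a strictly positive continuous probability density on $\Xi$, $g:\Xi\to[0,\infty)$ is infinitely differentiable, for every $\xi\in\Xi$ there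 is an integer $h\ge0$ such that the derivative $g^{(2h)}(\xi)$ is not zero (the least such $h$ is the order of $p^M$ at $\xi$), and $C_g=\int_\Xi g(\xi)p(\xi)\,d\xi$ is finite and strictly positive. **Theorem.** Let $\mathcal M$ be a nonsingleton model that is regular with respect to $q$, let $p^M$ be a regular generalized moment prior on $\Xi$, and let $m^M(y^{(n)})=\int_\Xi f^n(y^{(n)}\mid\xi)\,p^M(\xi)\,d\xi$. Then, as $n\to\infty$: (i) if $q\notin\mathcal M$, $\displaystyle \log\frac{m^M(y^{(n)})}{q^n(y^{(n)})}=-nK^\star+O_p(n^{1/2})$; (ii) if $q\in\mathcal M$, $\displaystyle \log\frac{m^M(y^{(n)})}{q^n(y^{(n)})}=-\frac d2\log n-h^\star\log n+O_p(1)$, where $h^\star$ is the order of $p^M$ at $\xi^\star$. If $\mathcal M=\{f^n(\cdot\mid\xi^\star)\}$ is a regular singleton model (no prior, $m^M(y^{(n)})=f^n(y^{(n)}\mid\xi^\star)$), then (i) holds unchanged, and (ii) holds with $d=0$ and $h^\star=0$. -/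

import Mathlib

open MeasureTheory Filter
open scoped ENNReal

noncomputable section

namespace MomentPrior

/-! ### Densities, likelihoods and stochastic order -/

/-- `q` is a strictly positive probability density with respect to the dominating measure `μ`
(for discrete data, `μ` is the counting measure). -/
structure IsPosDensity {Y : Type*} [MeasurableSpace Y] (μ : Measure Y) (q : Y → ℝ) : Prop where
  measurable : Measurable q
  pos : ∀ y, 0 < q y
  lintegral_eq_one : ∫⁻ y, ENNReal.ofReal (q y) ∂μ = 1

/-- The distribution on the sample space with density `q`. -/
def law {Y : Type*} [MeasurableSpace Y] (μ : Measure Y) (q : Y → ℝ) : Measure Y :=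
  μ.withDensity fun y => ENNReal.ofReal (q y)

/-- The joint density `qⁿ(y₁, …, yₙ) = q(y₁) ⋯ q(yₙ)` of `n` independent observations. -/
def jointDensity {Y : Type*} (q : Y → ℝ) {n : ℕ} (y : Fin n → Y) : ℝ :=
  ∏ i, q (y i)

/-- `y₁, y₂, …` (here indexed from `0`) are independent observations with density `q`. -/
structure IsIIDSample {Ω Y : Type*} [MeasurableSpace Ω] [MeasurableSpace Y] (P : Measure Ω)
    (y : ℕ → Ω → Y) (μ : Measure Y) (q : Y → ℝ) : Prop where
  measurable : ∀ i, Measurable (y i)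
  indep : ProbabilityTheory.iIndepFun y P
  map_eq : ∀ i, P.map (y i) = law μ q

/-- The data `y⁽ⁿ⁾ = (y₁, …, yₙ)`. -/
def sample {Ω Y : Type*} (y : ℕ → Ω → Y) (n : ℕ) (ω : Ω) : Fin n → Y :=
  fun i => y i ω

/-- `Xₙ = O_p(aₙ)` as `n → ∞`: the sequence `Xₙ / aₙ` is bounded in probability. -/
def IsBigOp {Ω : Type*} [MeasurableSpace Ω] (P : Measure Ω) (X : ℕ → Ω → ℝ) (a : ℕ → ℝ) : Prop :=
  ∀ ε : ℝ, 0 < ε → ∃ C : ℝ, ∀ᶠ n in atTop, P {ω | C * a n < |X n ω|} ≤ ENNReal.ofReal ε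

/-! ### Regular models -/

/-- The Kullback--Leibler divergence from the density `q` to the density `f`. -/
def kl {Y : Type*} [MeasurableSpace Y] (μ : Measure Y) (q f : Y → ℝ) : ℝ≥0∞ :=
  InformationTheory.klDiv (law μ q) (law μ f)

/-- The Kullback--Leibler divergence from the density `q` to the model `{f(· | ξ), ξ ∈ Ξ}`. -/
def klModel {Y E : Type*} [MeasurableSpace Y] (μ : Measure Y) (q : Y → ℝ) (Ξ : Set E)
    (f : E → Y → ℝ) : ℝ≥0∞ :=
  ⨅ ξ ∈ Ξ, kl μ q (f ξ)

/-- The density `q` belongs to the model `{f(· | ξ), ξ ∈ Ξ}`; densities are identified when they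
are equal almost everywhere (for discrete data, when they are equal). -/
def MemModel {Y E : Type*} [MeasurableSpace Y] (μ : Measure Y) (q : Y → ℝ) (Ξ : Set E)
    (f : E → Y → ℝ) : Prop :=
  ∃ ξ ∈ Ξ, f ξ =ᵐ[μ] q

/-- The unit log-likelihood `ξ ↦ log f(y | ξ)`. -/
def logLik {Y E : Type*} (f : E → Y → ℝ) (y : Y) (ξ : E) : ℝ :=
  Real.log (f ξ y)

/-- The second derivative of `ℓ` at `ξ` as a bilinear form. -/
def hess {d : ℕ} (ℓ : EuclideanSpace ℝ (Fin d) → ℝ) (ξ v w : EuclideanSpace ℝ (Fin d)) : ℝ :=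
  fderiv ℝ (fderiv ℝ ℓ) ξ v w

/-- The nonsingleton statistical model `{f(· | ξ), ξ ∈ Ξ}` is regular with respect to the
sampling density `q`, with Kullback--Leibler projection `f(· | ξs)`. -/
structure IsRegularModel {Y : Type*} [MeasurableSpace Y] (μ : Measure Y) (q : Y → ℝ) {d : ℕ}
    (Ξ : Set (EuclideanSpace ℝ (Fin d))) (f : EuclideanSpace ℝ (Fin d) → Y → ℝ)
    (ξs : EuclideanSpace ℝ (Fin d)) : Prop where
  /-- the parameter space is open and has more than one point -/
  isOpen : IsOpen Ξ
  nontrivial : Ξ.Nontrivial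
  /-- the model consists of strictly positive densities -/
  density : ∀ ξ ∈ Ξ, IsPosDensity μ (f ξ)
  /-- `ξs` is the unique minimizer of the divergence from `q` over `Ξ` -/
  proj_mem : ξs ∈ Ξ
  proj_eq : kl μ q (f ξs) = klModel μ q Ξ f
  proj_unique : ∀ ξ ∈ Ξ, kl μ q (f ξ) = klModel μ q Ξ f → ξ = ξs
  /-- the log-ratio of `q` to its projection has finite variance -/
  var_lt_top :
    ProbabilityTheory.evariance (fun y => Real.log (q y / f ξs y)) (law μ q) < ⊤
  /-- the unit log-likelihood is twice continuously differentiable -/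
  contDiffOn : ∀ y, ContDiffOn ℝ 2 (logLik f y) Ξ
  /-- moments of the log-likelihood and of the score at `ξs` -/
  integrable_logLik : Integrable (fun y => logLik f y ξs) (law μ q)
  integrable_score : Integrable (fun y => ‖gradient (logLik f y) ξs‖ ^ 2) (law μ q)
  /-- the entries of the Hessian are dominated on a ball around `ξs` -/
  hess_dominated : ∃ r : ℝ, 0 < r ∧ Metric.ball ξs r ⊆ Ξ ∧
    ∃ c : Y → ℝ, Integrable c (law μ q) ∧ ∀ y, ∀ ξ ∈ Metric.ball ξs r, ∀ i j : Fin d,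
      |hess (logLik f y) ξ (EuclideanSpace.single i 1) (EuclideanSpace.single j 1)| ≤ c y
  /-- the upper level sets of the average log-likelihood are connected (possibly empty) -/
  levelSets : ∀ n : ℕ, 1 ≤ n → ∀ y : Fin n → Y, ∀ t : ℝ,
    IsPreconnected {ξ ∈ Ξ | t < (n : ℝ)⁻¹ * ∑ i, logLik f (y i) ξ}
  /-- the expected Hessian of the log-likelihood at `ξs` is negative definite, that is, the
  divergence from `q` has a nondegenerate minimum at `ξs` -/
  hess_neg : ∀ v : EuclideanSpace ℝ (Fin d), v ≠ 0 →
    ∫ y, hess (logLik f y) ξs v v ∂(law μ q) < 0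

/-- The singleton model `{f}` is regular with respect to the sampling density `q`. -/
structure IsRegularSingleton {Y : Type*} [MeasurableSpace Y] (μ : Measure Y) (q f : Y → ℝ) :
    Prop where
  density : IsPosDensity μ f
  var_lt_top : ProbabilityTheory.evariance (fun y => Real.log (q y / f y)) (law μ q) < ⊤
  kl_lt_top : kl μ q f < ⊤

/-! ### Generalized moment priors -/

/-- The normalizing constant `C_g = ∫_Ξ g(ξ) p(ξ) dξ`. -/
def normConst {d : ℕ} (Ξ : Set (EuclideanSpace ℝ (Fin d)))
    (g p : EuclideanSpace ℝ (Fin d) → ℝ) : ℝ :=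
  ∫ ξ in Ξ, g ξ * p ξ

/-- The generalized moment prior density `p^M ∝ g p` on `Ξ`. -/
def momentPrior {d : ℕ} (Ξ : Set (EuclideanSpace ℝ (Fin d)))
    (g p : EuclideanSpace ℝ (Fin d) → ℝ) (ξ : EuclideanSpace ℝ (Fin d)) : ℝ :=
  g ξ * p ξ / normConst Ξ g p

/-- The order at `ξ` of the generalized moment prior with moment function `g`: the least `h ≥ 0`
such that the `2h`-th derivative of `g` at `ξ` is not zero. -/
def momentOrder {d : ℕ} (g : EuclideanSpace ℝ (Fin d) → ℝ) (ξ : EuclideanSpace ℝ (Fin d)) : ℕ :=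
  sInf {h : ℕ | iteratedFDeriv ℝ (2 * h) g ξ ≠ 0}

/-- The generalized moment prior `p^M ∝ g p` on `Ξ` is regular. -/
structure IsRegularMomentPrior {d : ℕ} (Ξ : Set (EuclideanSpace ℝ (Fin d)))
    (g p : EuclideanSpace ℝ (Fin d) → ℝ) : Prop where
  /-- the local prior is a strictly positive continuous probability density on `Ξ` -/
  prior_pos : ∀ ξ ∈ Ξ, 0 < p ξ
  prior_continuousOn : ContinuousOn p Ξ
  prior_lintegral : ∫⁻ ξ in Ξ, ENNReal.ofReal (p ξ) = 1
  /-- the moment function is nonnegative and infinitely smooth on `Ξ` -/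
  moment_nonneg : ∀ ξ ∈ Ξ, 0 ≤ g ξ
  moment_contDiffOn : ContDiffOn ℝ (⊤ : ℕ∞) g Ξ
  /-- the order is finite at every point of `Ξ` -/
  order_finite : ∀ ξ ∈ Ξ, ∃ h : ℕ, iteratedFDeriv ℝ (2 * h) g ξ ≠ 0
  /-- the normalizing constant is finite and strictly positive -/
  integrableOn : IntegrableOn (fun ξ => g ξ * p ξ) Ξ
  normConst_pos : 0 < normConst Ξ g p

/-- The marginal likelihood `m^M(y⁽ⁿ⁾) = ∫_Ξ fⁿ(y⁽ⁿ⁾ | ξ) p^M(ξ) dξ`. -/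
def marginalLik {Y : Type*} {d : ℕ} (Ξ : Set (EuclideanSpace ℝ (Fin d)))
    (f : EuclideanSpace ℝ (Fin d) → Y → ℝ) (g p : EuclideanSpace ℝ (Fin d) → ℝ) {n : ℕ}
    (y : Fin n → Y) : ℝ :=
  ∫ ξ in Ξ, jointDensity (f ξ) y * momentPrior Ξ g p ξ

end MomentPrior

end

/-!
Write `ℓₙ(ξ)` for the log-likelihood of the first `n` observations, `ξs` for the Kullback--Leibler
projection and `h` for the order of the prior at `ξs`. The marginal likelihood factors as
`fⁿ(y | ξs) * Iₙ`, where `Iₙ = ∫ exp (ℓₙ(ξ) - ℓₙ(ξs)) pᴹ(ξ) dξ` (`marginalLik_eq`).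

The factor `log (fⁿ(y | ξs) / qⁿ(y))` is a sum of i.i.d. variables with mean `-K⋆` and finite
variance, so it is `-n K⋆ + O_p(√n)` by Chebyshev's inequality; it vanishes almost surely if `q`
belongs to the model, since then `f(· | ξs) = q` by uniqueness of the projection.

The factor `log Iₙ` is `-(d / 2 + h) log n + O_p(1)` in both cases (`exists_log_integral_bound`), by
Laplace's method:

* near `ξs`, `ℓₙ(ξs + x) - ℓₙ(ξs)` lies between `-A √n ‖x‖ - Λ n ‖x‖²` and `A √n ‖x‖ - λ n ‖x‖²`
  with large probability, where `λ > 0` (`exists_quadratic_bounds`). The linear term is the score,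
  which is centred because `ξs` minimizes the divergence (`integral_score_eq_zero`) and is bounded by
  Chebyshev's inequality; the quadratic term is the Hessian at `ξs`, to which the law of large numbers applies; the remainder is
  dominated by a measurable envelope with small mean on a small ball (`exists_lintegral_remSup_le`),
  and Markov's inequality suffices;
* away from `ξs`, `ℓₙ - ℓₙ(ξs)` is at most `-δ n`: this holds on a sphere around `ξs` by the quadratic
  bound, and it extends to the exterior because the upper level sets are connected
  (`le_of_isPreconnected_of_sphere`);
* the prior is at most of order `‖x‖ ^ (2 h)` near `ξs`, and of exactly this order in a cone of
  directions (`momentPrior_local_bounds`): the first nonvanishing derivative of the nonnegative moment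
  function has even order and, being symmetric, is nonzero and hence positive on some diagonal.

On the scale `x = u / √n` both bounds give the order `n ^ (-(d / 2 + h))` (`exists_laplace_bound`).
-/

/-! ### Symmetry of iterated derivatives and Taylor's formula on segments -/

namespace MomentPrior
open Topology Set
open scoped Nat ContDiff

section Calculus

variable {E : Type*} [NormedAddCommGroup E] [NormedSpace ℝ E]

theorem iteratedFDeriv_succ_apply_eq_fderiv {f : E → ℝ} {s : Set E} (hs : IsOpen s)
    (hf : ContDiffOn ℝ ∞ f s) {x : E} (hx : x ∈ s) (k : ℕ) (m : Fin (k + 1) → E) :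
    iteratedFDeriv ℝ (k + 1) f x m =
      fderiv ℝ (fun z => iteratedFDeriv ℝ k f z (Fin.tail m)) x (m 0) :=
  DifferentiableAt.iteratedFDeriv_succ_apply_left'
    ((hf.contDiffAt (hs.mem_nhds hx)).differentiableAt_iteratedFDeriv
      (by exact_mod_cast ENat.natCast_lt_top k))

/-- Invariance of the iterated derivatives of a smooth function under adjacent transpositions: the
first two arguments commute by the symmetry of second derivatives, the others by differentiating the
invariance of the derivative of lower order. -/
theorem iteratedFDeriv_comp_swap {f : E → ℝ} {s : Set E} (hs : IsOpen s)
    (hf : ContDiffOn ℝ ∞ f s) (k : ℕ) (i : Fin k) {x : E} (hx : x ∈ s) (m : Fin (k + 1) → E) :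
    iteratedFDeriv ℝ (k + 1) f x (m ∘ Equiv.swap i.castSucc i.succ) =
      iteratedFDeriv ℝ (k + 1) f x m := by
  induction k generalizing x with
  | zero => exact i.elim0
  | succ k ih =>
    rw [iteratedFDeriv_succ_apply_eq_fderiv hs hf hx, iteratedFDeriv_succ_apply_eq_fderiv hs hf hx]
    refine Fin.cases ?_ (fun j => ?_) i
    · have key : ∀ v : Fin (k + 2) → E,
          fderiv ℝ (fun z => iteratedFDeriv ℝ (k + 1) f z (Fin.tail v)) x (v 0) =
            fderiv ℝ (fderiv ℝ (iteratedFDeriv ℝ k f)) x (v 0) (v 1) (Fin.tail (Fin.tail v)) := by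
        intro v
        have hd : DifferentiableAt ℝ (fderiv ℝ (iteratedFDeriv ℝ k f)) x := by
          have h1 : ContDiffAt ℝ 2 (iteratedFDeriv ℝ k f) x :=
            (hf.contDiffAt (hs.mem_nhds hx)).iteratedFDeriv_right
              (WithTop.coe_le_coe.2 (le_top : (2 : ℕ∞) + k ≤ ⊤))
          exact (h1.fderiv_right (m := 1) (by norm_num)).differentiableAt (by norm_num)
        have h2 : (fun z => iteratedFDeriv ℝ (k + 1) f z (Fin.tail v)) =
            fun z => fderiv ℝ (iteratedFDeriv ℝ k f) z (v 1) (Fin.tail (Fin.tail v)) := by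
          funext z
          rw [iteratedFDeriv_succ_apply_left]
          rfl
        rw [h2]
        have h3 := hd.hasFDerivAt.clm_apply (hasFDerivAt_const (v 1) x)
        have h4 := ((ContinuousMultilinearMap.apply ℝ (fun _ : Fin k => E) ℝ
          (Fin.tail (Fin.tail v))).hasFDerivAt.comp x h3).fderiv
        refine (congrArg (fun L : E →L[ℝ] ℝ => L (v 0)) h4).trans ?_
        simp
      have h5 : IsSymmSndFDerivAt ℝ (iteratedFDeriv ℝ k f) x := by
        have h1 : ContDiffAt ℝ 2 (iteratedFDeriv ℝ k f) x :=
            (hf.contDiffAt (hs.mem_nhds hx)).iteratedFDeriv_right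
              (WithTop.coe_le_coe.2 (le_top : (2 : ℕ∞) + k ≤ ⊤))
        exact h1.isSymmSndFDerivAt (by simp)
      rw [key, key]
      have e0 : (m ∘ Equiv.swap (0 : Fin (k + 1)).castSucc (0 : Fin (k + 1)).succ) 0 = m 1 := by
        simp
      have e1 : (m ∘ Equiv.swap (0 : Fin (k + 1)).castSucc (0 : Fin (k + 1)).succ) 1 = m 0 := by
        simp
      have e2 : Fin.tail (Fin.tail
          (m ∘ Equiv.swap (0 : Fin (k + 1)).castSucc (0 : Fin (k + 1)).succ)) =
          Fin.tail (Fin.tail m) := by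
        funext l
        simp only [Fin.tail, Function.comp_apply]
        rw [Equiv.swap_apply_of_ne_of_ne]
        · simp [Fin.ext_iff]
        · simp [Fin.ext_iff]
      rw [e0, e1, e2, h5.eq]
    · have e0 : (m ∘ Equiv.swap j.succ.castSucc j.succ.succ) 0 = m 0 := by
        simp only [Function.comp_apply]
        rw [Equiv.swap_apply_of_ne_of_ne]
        · simp [Fin.ext_iff]
        · simp [Fin.ext_iff]
      have e1 : Fin.tail (m ∘ Equiv.swap j.succ.castSucc j.succ.succ) =
          Fin.tail m ∘ Equiv.swap j.castSucc j.succ := by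
        funext l
        simp only [Fin.tail, Function.comp_apply, ← Fin.succ_castSucc]
        rw [(Fin.succ_injective _).swap_apply]
      rw [e0, e1]
      congr 1
      refine Filter.EventuallyEq.fderiv_eq ?_
      filter_upwards [hs.mem_nhds hx] with z hz
      exact ih j hz _

/-- The iterated derivatives of a smooth function are symmetric. -/
theorem iteratedFDeriv_comp_perm {f : E → ℝ} {s : Set E} (hs : IsOpen s)
    (hf : ContDiffOn ℝ ∞ f s) {k : ℕ} (σ : Equiv.Perm (Fin k)) {x : E} (hx : x ∈ s)
    (m : Fin k → E) :
    iteratedFDeriv ℝ k f x (m ∘ σ) = iteratedFDeriv ℝ k f x m := by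
  cases k with
  | zero => exact congrArg _ (Subsingleton.elim _ _)
  | succ k =>
    have hσ : σ ∈ Submonoid.closure
        (Set.range fun i : Fin k => Equiv.swap i.castSucc i.succ) := by
      rw [Equiv.Perm.mclosure_swap_castSucc_succ]; trivial
    induction hσ using Submonoid.closure_induction generalizing m with
    | mem τ hτ =>
      obtain ⟨i, rfl⟩ := hτ
      exact iteratedFDeriv_comp_swap hs hf k i hx m
    | one => rfl
    | mul a b _ _ ha hb =>
      have : m ∘ (a * b : Equiv.Perm (Fin (k + 1))) = (m ∘ a) ∘ b := rfl
      rw [this, hb, ha]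

/-- A nonzero iterated derivative of a smooth function is nonzero on the diagonal. Polarization is
obtained by differentiating the diagonal `k` times, which gives `k !` times the symmetric form. -/
theorem exists_iteratedFDeriv_diag_ne_zero {f : E → ℝ} {s : Set E} (hs : IsOpen s)
    (hf : ContDiffOn ℝ ∞ f s) {k : ℕ} {x : E} (hx : x ∈ s) (h : iteratedFDeriv ℝ k f x ≠ 0) :
    ∃ v : E, iteratedFDeriv ℝ k f x (fun _ => v) ≠ 0 := by
  by_contra! h0
  apply h
  ext m
  have h1 := (iteratedFDeriv ℝ k f x).iteratedFDeriv_comp_diagonal 0 m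
  have h2 : (fun v : E => iteratedFDeriv ℝ k f x (fun _ => v)) = fun _ => 0 := funext h0
  have h3 : ∀ σ : Equiv.Perm (Fin k), iteratedFDeriv ℝ k f x (fun i => m (σ i)) =
      iteratedFDeriv ℝ k f x m := fun σ => iteratedFDeriv_comp_perm hs hf σ hx m
  simp only [h3, h2, Finset.sum_const, nsmul_eq_mul] at h1
  rw [show (fun _ : E => (0 : ℝ)) = 0 from rfl, iteratedFDeriv_zero] at h1
  have h4 : ((Finset.univ : Finset (Equiv.Perm (Fin k))).card : ℝ) ≠ 0 := by
    exact_mod_cast Finset.card_ne_zero_of_mem (Finset.mem_univ 1)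
  simpa [h4] using h1.symm

/-- The derivatives of a function along a line are its iterated derivatives on the diagonal. -/
theorem iteratedDeriv_comp_line {f : E → ℝ} {s : Set E} (hs : IsOpen s) {N : ℕ}
    (hf : ContDiffOn ℝ N f s) (a x : E) {k : ℕ} (hk : k ≤ N) {t : ℝ} (ht : a + t • x ∈ s) :
    iteratedDeriv k (fun u : ℝ => f (a + u • x)) t =
      iteratedFDeriv ℝ k f (a + t • x) (fun _ => x) := by
  induction k generalizing t with
  | zero => simp
  | succ k ih =>
    have hl : HasDerivAt (fun u : ℝ => a + u • x) x t := by
      simpa using ((hasDerivAt_id t).smul_const x).const_add a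
    have hnear : ∀ᶠ u in 𝓝 t, a + u • x ∈ s :=
      hl.continuousAt.eventually (hs.mem_nhds ht)
    have h1 : iteratedDeriv k (fun u : ℝ => f (a + u • x)) =ᶠ[𝓝 t]
        fun u => iteratedFDeriv ℝ k f (a + u • x) (fun _ => x) := by
      filter_upwards [hnear] with u hu
      exact ih (by omega) hu
    rw [iteratedDeriv_succ, h1.deriv_eq, iteratedFDeriv_succ_apply_left]
    have hd : DifferentiableAt ℝ (iteratedFDeriv ℝ k f) (a + t • x) :=
      (hf.contDiffAt (hs.mem_nhds ht)).differentiableAt_iteratedFDeriv (by exact_mod_cast hk)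
    have h2 := (ContinuousMultilinearMap.apply ℝ (fun _ : Fin k => E) ℝ
      (fun _ => x)).hasFDerivAt.comp_hasDerivAt t (hd.hasFDerivAt.comp_hasDerivAt t hl)
    exact h2.deriv

/-- Taylor's formula with the Lagrange remainder along a segment. -/
theorem exists_taylor_segment {f : E → ℝ} {s : Set E} (hs : IsOpen s) {k : ℕ}
    (hf : ContDiffOn ℝ k f s) (a x : E) (hseg : ∀ t ∈ Icc (0 : ℝ) 1, a + t • x ∈ s) :
    ∃ t ∈ Icc (0 : ℝ) 1, f (a + x) =
      ∑ j ∈ Finset.range k, (j ! : ℝ)⁻¹ * iteratedFDeriv ℝ j f a (fun _ => x) +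
        (k ! : ℝ)⁻¹ * iteratedFDeriv ℝ k f (a + t • x) (fun _ => x) := by
  cases k with
  | zero => exact ⟨1, by simp, by simp⟩
  | succ k =>
    have hφ : ∀ t ∈ Icc (0 : ℝ) 1, ContDiffAt ℝ ((k + 1 : ℕ) : WithTop ℕ∞)
        (fun u : ℝ => f (a + u • x)) t := fun t ht =>
      ContDiffAt.comp (g := f) (f := fun u : ℝ => a + u • x) t
        (hf.contDiffAt (hs.mem_nhds (hseg t ht)))
        (contDiffAt_const.add (contDiffAt_id.smul contDiffAt_const))
    have h01 : uIcc (0 : ℝ) 1 = Icc 0 1 := uIcc_of_le zero_le_one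
    have hu : UniqueDiffOn ℝ (Icc (0 : ℝ) 1) := uniqueDiffOn_Icc zero_lt_one
    obtain ⟨t, ht, hE⟩ := taylor_mean_remainder_lagrange_iteratedDeriv
      (f := fun u : ℝ => f (a + u • x)) (x₀ := 0) (x := 1) (n := k) zero_ne_one
      (by rw [h01]; exact fun t ht => (hφ t ht).contDiffWithinAt)
    rw [uIoo_of_le zero_le_one] at ht
    have ht' : t ∈ Icc (0 : ℝ) 1 := Ioo_subset_Icc_self ht
    refine ⟨t, ht', ?_⟩
    rw [iteratedDeriv_comp_line hs hf a x le_rfl (hseg t ht'), taylor_within_apply, h01] at hE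
    have hsum : ∀ j ∈ Finset.range (k + 1),
        (((j ! : ℝ)⁻¹ * (1 - 0) ^ j) • iteratedDerivWithin j (fun u : ℝ => f (a + u • x))
          (Icc 0 1) 0) = (j ! : ℝ)⁻¹ * iteratedFDeriv ℝ j f a (fun _ => x) := by
      intro j hj
      have hj' : j ≤ k + 1 := (Finset.mem_range.mp hj).le
      have h0 : (0 : ℝ) ∈ Icc (0 : ℝ) 1 := by simp
      rw [iteratedDerivWithin_eq_iteratedDeriv hu
        ((hφ 0 h0).of_le (by exact_mod_cast hj')) h0,
        iteratedDeriv_comp_line hs hf a x hj' (hseg 0 h0)]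
      simp
    rw [Finset.sum_congr rfl hsum] at hE
    simp only [one_smul, sub_zero, one_pow, mul_one] at hE
    rw [eq_add_of_sub_eq' hE]
    ring

end Calculus
end MomentPrior

/-! ### Local order of the moment prior -/

namespace MomentPrior
open Topology Set
open scoped Nat ContDiff

section Vanishing

variable {E : Type*} [NormedAddCommGroup E] [NormedSpace ℝ E]

/-- Taylor's formula at a point where all derivatives of order less than `k` vanish. -/
theorem exists_taylor_of_vanishing {f : E → ℝ} {s : Set E} (hs : IsOpen s)
    (hf : ContDiffOn ℝ ∞ f s) {a : E} {k : ℕ} (hvan : ∀ j < k, iteratedFDeriv ℝ j f a = 0)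
    {x : E} (hseg : ∀ t ∈ Icc (0 : ℝ) 1, a + t • x ∈ s) :
    ∃ t ∈ Icc (0 : ℝ) 1,
      f (a + x) = (k ! : ℝ)⁻¹ * iteratedFDeriv ℝ k f (a + t • x) (fun _ => x) := by
  obtain ⟨t, ht, h⟩ := exists_taylor_segment hs (k := k)
    (hf.of_le (by exact_mod_cast (le_top : (k : ℕ∞) ≤ ⊤))) a x hseg
  refine ⟨t, ht, ?_⟩
  rw [h, Finset.sum_eq_zero, zero_add]
  intro j hj
  simp [hvan j (Finset.mem_range.mp hj)]

theorem norm_smul_le_of_mem_Icc {t : ℝ} (ht : t ∈ Icc (0 : ℝ) 1) (x : E) : ‖t • x‖ ≤ ‖x‖ := by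
  rw [norm_smul, Real.norm_of_nonneg ht.1]
  exact mul_le_of_le_one_left (norm_nonneg _) ht.2

theorem continuousAt_iteratedFDeriv_diag {f : E → ℝ} {s : Set E} (hs : IsOpen s)
    (hf : ContDiffOn ℝ ∞ f s) {a : E} (ha : a ∈ s) (k : ℕ) (u : E) :
    ContinuousAt (fun z : E × E => iteratedFDeriv ℝ k f z.1 (fun _ => z.2)) (a, u) := by
  have h1 : ContinuousAt (iteratedFDeriv ℝ k f) a :=
    (hf.contDiffAt (hs.mem_nhds ha)).continuousAt_iteratedFDeriv
      (by exact_mod_cast (le_top : (k : ℕ∞) ≤ ⊤))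
  have h2 : ContinuousAt (fun z : E × E => iteratedFDeriv ℝ k f z.1) (a, u) :=
    ContinuousAt.comp (g := iteratedFDeriv ℝ k f) (f := Prod.fst) (x := (a, u)) h1 continuousAt_fst
  have h3 : ContinuousAt (fun z : E × E => (fun _ : Fin k => z.2)) (a, u) :=
    continuousAt_pi.2 fun _ => continuousAt_snd
  exact continuous_eval.continuousAt.comp₂ h2 h3

/-- Near a point where all derivatives of order less than `k` vanish, a smooth function is of
order at most `‖x‖ ^ k`. -/
theorem exists_le_norm_pow {f : E → ℝ} {s : Set E} (hs : IsOpen s)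
    (hf : ContDiffOn ℝ ∞ f s) {a : E} (ha : a ∈ s) {k : ℕ}
    (hvan : ∀ j < k, iteratedFDeriv ℝ j f a = 0) :
    ∃ ρ > 0, ∃ M : ℝ, ∀ x : E, ‖x‖ < ρ → a + x ∈ s ∧ f (a + x) ≤ M * ‖x‖ ^ k := by
  have h1 : ContinuousAt (iteratedFDeriv ℝ k f) a :=
    (hf.contDiffAt (hs.mem_nhds ha)).continuousAt_iteratedFDeriv
      (by exact_mod_cast (le_top : (k : ℕ∞) ≤ ⊤))
  have h2 : ∀ᶠ z in 𝓝 a, ‖iteratedFDeriv ℝ k f z‖ < ‖iteratedFDeriv ℝ k f a‖ + 1 :=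
    h1.norm.eventually (gt_mem_nhds (lt_add_one _))
  have h3 : ∀ᶠ z in 𝓝 a, z ∈ s := hs.mem_nhds ha
  obtain ⟨ρ, hρ, hball⟩ := Metric.eventually_nhds_iff.1 (h2.and h3)
  refine ⟨ρ, hρ, (k ! : ℝ)⁻¹ * (‖iteratedFDeriv ℝ k f a‖ + 1), fun x hx => ?_⟩
  have hin : ∀ t ∈ Icc (0 : ℝ) 1, dist (a + t • x) a < ρ := fun t ht => by
    rw [dist_self_add_left]
    exact (norm_smul_le_of_mem_Icc ht x).trans_lt hx
  refine ⟨by simpa using (hball (hin 1 (by simp))).2, ?_⟩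
  obtain ⟨t, ht, h⟩ := exists_taylor_of_vanishing hs hf hvan (x := x)
    fun t ht => (hball (hin t ht)).2
  rw [h, mul_assoc]
  gcongr
  calc iteratedFDeriv ℝ k f (a + t • x) (fun _ => x)
      ≤ ‖iteratedFDeriv ℝ k f (a + t • x) (fun _ => x)‖ := Real.le_norm_self _
    _ ≤ ‖iteratedFDeriv ℝ k f (a + t • x)‖ * ‖x‖ ^ k := by
        simpa using (iteratedFDeriv ℝ k f (a + t • x)).le_opNorm (fun _ => x)
    _ ≤ _ := by
        gcongr
        exact (hball (hin t ht)).1.le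

/-- If the first nonvanishing derivative of a smooth function is positive in the direction `u₀`,
then the function is of exact order `t ^ k` along the rays in directions close to `u₀`. -/
theorem exists_pow_le_of_diag_pos {f : E → ℝ} {s : Set E} (hs : IsOpen s)
    (hf : ContDiffOn ℝ ∞ f s) {a : E} (ha : a ∈ s) {k : ℕ}
    (hvan : ∀ j < k, iteratedFDeriv ℝ j f a = 0) {u₀ : E}
    (hu₀ : 0 < iteratedFDeriv ℝ k f a (fun _ => u₀)) :
    ∃ ρ > 0, ∃ c > 0, ∃ τ > 0, ∀ t : ℝ, 0 < t → t ≤ τ → ∀ u ∈ Metric.ball u₀ ρ,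
      a + t • u ∈ s ∧ c * t ^ k ≤ f (a + t • u) := by
  set b := iteratedFDeriv ℝ k f a (fun _ => u₀) with hb
  have h1 : ∀ᶠ z in 𝓝 (a, u₀), b / 2 < iteratedFDeriv ℝ k f z.1 (fun _ => z.2) :=
    (continuousAt_iteratedFDeriv_diag hs hf ha k u₀).eventually (lt_mem_nhds (half_lt_self hu₀))
  have h2 : ∀ᶠ z in 𝓝 (a, u₀), z.1 ∈ s := continuousAt_fst.eventually (hs.mem_nhds ha)
  obtain ⟨ρ, hρ, hball⟩ := Metric.eventually_nhds_iff.1 (h1.and h2)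
  have hK : 0 < ‖u₀‖ + ρ := by positivity
  refine ⟨ρ, hρ, (k ! : ℝ)⁻¹ * (b / 2), by positivity, ρ / (2 * (‖u₀‖ + ρ)), by positivity,
    fun t ht htτ u hu => ?_⟩
  have hun : ‖u‖ ≤ ‖u₀‖ + ρ := by
    have := norm_sub_norm_le u u₀
    rw [Metric.mem_ball, dist_eq_norm] at hu
    linarith
  have htu : ‖t • u‖ < ρ := by
    rw [norm_smul, Real.norm_of_nonneg ht.le]
    calc t * ‖u‖ ≤ ρ / (2 * (‖u₀‖ + ρ)) * (‖u₀‖ + ρ) := by gcongr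
      _ = ρ / 2 := by field_simp
      _ < ρ := half_lt_self hρ
  have hin : ∀ θ ∈ Icc (0 : ℝ) 1, dist (a + θ • t • u, u) (a, u₀) < ρ := fun θ hθ => by
    rw [Prod.dist_eq, max_lt_iff]
    refine ⟨?_, hu⟩
    rw [dist_self_add_left]
    exact (norm_smul_le_of_mem_Icc hθ _).trans_lt htu
  refine ⟨by simpa using (hball (hin 1 (by simp))).2, ?_⟩
  obtain ⟨θ, hθ, h⟩ := exists_taylor_of_vanishing hs hf hvan (x := t • u)
    fun θ hθ => (hball (hin θ hθ)).2
  have hhom : iteratedFDeriv ℝ k f (a + θ • t • u) (fun _ => t • u) =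
      t ^ k * iteratedFDeriv ℝ k f (a + θ • t • u) (fun _ => u) := by
    have := (iteratedFDeriv ℝ k f (a + θ • t • u)).map_smul_univ (fun _ => t) (fun _ => u)
    simpa using this
  rw [h, hhom, mul_assoc, mul_comm (b / 2)]
  gcongr
  exact (hball (hin θ hθ)).1.le

/-- The first nonvanishing derivative of a nonnegative smooth function is nonnegative on the
diagonal: otherwise the function would be negative somewhere on the corresponding ray. -/
theorem iteratedFDeriv_diag_nonneg {f : E → ℝ} {s : Set E} (hs : IsOpen s)
    (hf : ContDiffOn ℝ ∞ f s) (hnn : ∀ z ∈ s, 0 ≤ f z) {a : E} (ha : a ∈ s) {k : ℕ}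
    (hvan : ∀ j < k, iteratedFDeriv ℝ j f a = 0) (u : E) :
    0 ≤ iteratedFDeriv ℝ k f a (fun _ => u) := by
  by_contra! hneg
  have hD : ∀ j, iteratedFDeriv ℝ j (-f) a = -iteratedFDeriv ℝ j f a := fun j => by
    rw [iteratedFDeriv_neg]; rfl
  obtain ⟨ρ, hρ, c, hc, τ, hτ, h⟩ := exists_pow_le_of_diag_pos hs (f := -f) hf.neg ha
    (k := k) (fun j hj => by rw [hD, hvan j hj, neg_zero]) (u₀ := u)
    (by rw [hD]; simpa using hneg)
  obtain ⟨h1, h2⟩ := h τ hτ le_rfl u (Metric.mem_ball_self hρ)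
  have h3 := hnn _ h1
  have h4 : 0 < c * τ ^ k := by positivity
  simp only [Pi.neg_apply] at h2
  linarith

end Vanishing

/-- The first nonvanishing derivative of a nonnegative smooth function has even order, twice the
order of the moment prior, and it is positive in some direction. -/
theorem momentOrder_spec {d : ℕ} {Ξ : Set (EuclideanSpace ℝ (Fin d))} (hΞ : IsOpen Ξ)
    {g : EuclideanSpace ℝ (Fin d) → ℝ} (hg : ContDiffOn ℝ ∞ g Ξ) (hnn : ∀ z ∈ Ξ, 0 ≤ g z)
    {a : EuclideanSpace ℝ (Fin d)} (ha : a ∈ Ξ) (hfin : ∃ h : ℕ, iteratedFDeriv ℝ (2 * h) g a ≠ 0) :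
    (∀ j < 2 * momentOrder g a, iteratedFDeriv ℝ j g a = 0) ∧
      ∃ u, 0 < iteratedFDeriv ℝ (2 * momentOrder g a) g a (fun _ => u) := by
  classical
  have hex : ∃ k : ℕ, iteratedFDeriv ℝ k g a ≠ 0 := let ⟨h, hh⟩ := hfin; ⟨2 * h, hh⟩
  have hvan : ∀ j < Nat.find hex, iteratedFDeriv ℝ j g a = 0 := fun j hj =>
    not_not.1 (Nat.find_min hex hj)
  have hk := Nat.find_spec hex
  set k := Nat.find hex with hkdef
  obtain ⟨v, hv⟩ := exists_iteratedFDeriv_diag_ne_zero hΞ hg ha hk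
  have hpos := iteratedFDeriv_diag_nonneg hΞ hg hnn ha hvan
  -- for odd `k` the diagonal is an odd function, which cannot be nonnegative and nonzero
  have heven : Even k := by
    by_contra hodd
    rw [Nat.not_even_iff_odd] at hodd
    have h1 := (iteratedFDeriv ℝ k g a).map_smul_univ (fun _ => (-1 : ℝ)) (fun _ => v)
    simp only [Finset.prod_const, Finset.card_univ, Fintype.card_fin, hodd.neg_one_pow,
      smul_eq_mul, neg_mul, one_mul] at h1
    have h2 := hpos ((-1 : ℝ) • v)
    rw [h1] at h2
    exact hv (le_antisymm (by linarith) (hpos v))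
  obtain ⟨h, hh⟩ := heven.two_dvd
  have hord : momentOrder g a = h := by
    refine le_antisymm (Nat.sInf_le (by rw [mem_ofPred_eq, ← hh]; exact hk)) ?_
    refine le_csInf hfin fun j hj => ?_
    by_contra! hlt
    exact hj (hvan _ (by omega))
  rw [hord, ← hh]
  exact ⟨hvan, v, (hpos v).lt_of_ne' hv⟩

/-- Local behaviour of the moment prior density at a point of order `h`: it is bounded by a multiple
of `‖x‖ ^ (2 h)`, and of this exact order in a cone of directions. -/
theorem momentPrior_local_bounds {d : ℕ} {Ξ : Set (EuclideanSpace ℝ (Fin d))} (hΞ : IsOpen Ξ)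
    {g p : EuclideanSpace ℝ (Fin d) → ℝ} (hgp : IsRegularMomentPrior Ξ g p)
    {a : EuclideanSpace ℝ (Fin d)} (ha : a ∈ Ξ) :
    (∃ ρ > 0, ∃ M : ℝ, ∀ x : EuclideanSpace ℝ (Fin d), ‖x‖ < ρ → a + x ∈ Ξ ∧
      momentPrior Ξ g p (a + x) ≤ M * ‖x‖ ^ (2 * momentOrder g a)) ∧
    ∃ u₀ : EuclideanSpace ℝ (Fin d), ∃ ρ > 0, ∃ c > 0, ∃ τ > 0, ∀ t : ℝ, 0 < t → t ≤ τ →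
      ∀ u ∈ Metric.ball u₀ ρ, a + t • u ∈ Ξ ∧
        c * t ^ (2 * momentOrder g a) ≤ momentPrior Ξ g p (a + t • u) := by
  obtain ⟨hvan, u₀, hu₀⟩ := momentOrder_spec hΞ hgp.moment_contDiffOn hgp.moment_nonneg ha
    (hgp.order_finite a ha)
  have hC := hgp.normConst_pos
  have hpa := hgp.prior_pos a ha
  have hpc : ContinuousAt p a := hgp.prior_continuousOn.continuousAt (hΞ.mem_nhds ha)
  have h1 : ∀ᶠ z in 𝓝 a, p z < 2 * p a := hpc.eventually (gt_mem_nhds (by linarith))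
  have h2 : ∀ᶠ z in 𝓝 a, p a / 2 < p z := hpc.eventually (lt_mem_nhds (half_lt_self hpa))
  obtain ⟨η, hη, hball⟩ := Metric.eventually_nhds_iff.1 (h1.and h2)
  constructor
  · obtain ⟨ρ, hρ, M, hM⟩ := exists_le_norm_pow hΞ hgp.moment_contDiffOn ha hvan
    refine ⟨min ρ η, lt_min hρ hη, M * (2 * p a) / normConst Ξ g p, fun x hx => ?_⟩
    obtain ⟨hx1, hx2⟩ := hM x (hx.trans_le (min_le_left _ _))
    refine ⟨hx1, ?_⟩
    have hp := (@hball (a + x) (by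
      rw [dist_self_add_left]; exact hx.trans_le (min_le_right _ _))).1
    have hg0 := hgp.moment_nonneg _ hx1
    unfold momentPrior
    rw [div_mul_eq_mul_div]
    refine (div_le_div_iff_of_pos_right hC).2 ?_
    calc g (a + x) * p (a + x) ≤ g (a + x) * (2 * p a) := by gcongr
      _ ≤ M * ‖x‖ ^ (2 * momentOrder g a) * (2 * p a) := by gcongr
      _ = _ := by ring
  · obtain ⟨ρ, hρ, c, hc, τ, hτ, h⟩ :=
      exists_pow_le_of_diag_pos hΞ hgp.moment_contDiffOn ha hvan hu₀
    have hK : 0 < ‖u₀‖ + ρ := by positivity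
    refine ⟨u₀, ρ, hρ, c * (p a / 2) / normConst Ξ g p, by positivity,
      min τ (η / (2 * (‖u₀‖ + ρ))), by positivity, fun t ht htτ u hu => ?_⟩
    obtain ⟨hx1, hx2⟩ := h t ht (htτ.trans (min_le_left _ _)) u hu
    refine ⟨hx1, ?_⟩
    have hun : ‖u‖ ≤ ‖u₀‖ + ρ := by
      have := norm_sub_norm_le u u₀
      rw [Metric.mem_ball, dist_eq_norm] at hu
      linarith
    have htu : ‖t • u‖ < η := by
      rw [norm_smul, Real.norm_of_nonneg ht.le]
      calc t * ‖u‖ ≤ η / (2 * (‖u₀‖ + ρ)) * (‖u₀‖ + ρ) := by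
            gcongr; exact htτ.trans (min_le_right _ _)
        _ = η / 2 := by field_simp
        _ < η := half_lt_self hη
    have hp := (@hball (a + t • u) (by rw [dist_self_add_left]; exact htu)).2
    unfold momentPrior
    rw [div_mul_eq_mul_div]
    refine (div_le_div_iff_of_pos_right hC).2 ?_
    calc c * (p a / 2) * t ^ (2 * momentOrder g a)
        = c * t ^ (2 * momentOrder g a) * (p a / 2) := by ring
      _ ≤ g (a + t • u) * p (a + t • u) := by
          gcongr
          exact hgp.moment_nonneg _ hx1

end MomentPrior

/-! ### Laplace's method with uniform constants -/

namespace MomentPrior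
open Topology Set
open scoped Nat ContDiff

section Laplace

theorem integrable_norm_pow_mul_exp_neg_mul_sq {E : Type*} [NormedAddCommGroup E]
    [NormedSpace ℝ E] [FiniteDimensional ℝ E] [MeasurableSpace E] [BorelSpace E] (μ : Measure E)
    [μ.IsAddHaarMeasure] (k : ℕ) {b : ℝ} (hb : 0 < b) :
    Integrable (fun u : E => ‖u‖ ^ k * Real.exp (-b * ‖u‖ ^ 2)) μ := by
  set N := k + (Module.finrank ℝ E + 1) with hN
  have h0 : Integrable (fun u : E => (1 + ‖u‖) ^ (-((Module.finrank ℝ E + 1 : ℕ) : ℝ))) μ :=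
    integrable_one_add_norm (by push_cast; linarith)
  refine (h0.const_mul (Real.exp (1 + 1 / (4 * b)) * N !)).mono'
    (by fun_prop) (Eventually.of_forall fun u => ?_)
  have hu : 0 ≤ ‖u‖ := norm_nonneg u
  -- `b ‖u‖² ≥ ‖u‖ - 1 / (4 b)` reduces to exponential decay, which beats every power
  have h1 : Real.exp (-b * ‖u‖ ^ 2) ≤ Real.exp (1 + 1 / (4 * b)) * Real.exp (-(1 + ‖u‖)) := by
    rw [← Real.exp_add, Real.exp_le_exp]
    have h2 : b * ‖u‖ ^ 2 - ‖u‖ + 1 / (4 * b) = b * (‖u‖ - 1 / (2 * b)) ^ 2 := by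
      field_simp
      ring
    have h3 : 0 ≤ b * (‖u‖ - 1 / (2 * b)) ^ 2 := by positivity
    linarith
  have h4 : Real.exp (-(1 + ‖u‖)) ≤ N ! / (1 + ‖u‖) ^ N := by
    have h5 := Real.pow_div_factorial_le_exp (1 + ‖u‖) (by positivity) N
    have h6 : 0 < (N ! : ℝ) := by exact_mod_cast N.factorial_pos
    rw [Real.exp_neg, inv_le_comm₀ (Real.exp_pos _) (by positivity), inv_div]
    exact h5
  rw [Real.norm_of_nonneg (by positivity)]
  calc ‖u‖ ^ k * Real.exp (-b * ‖u‖ ^ 2)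
      ≤ (1 + ‖u‖) ^ k * (Real.exp (1 + 1 / (4 * b)) * (N ! / (1 + ‖u‖) ^ N)) := by
        gcongr
        · linarith
        · exact h1.trans (by gcongr)
    _ = Real.exp (1 + 1 / (4 * b)) * N ! * (1 + ‖u‖) ^ (-((Module.finrank ℝ E + 1 : ℕ) : ℝ)) := by
        rw [Real.rpow_neg (by positivity), Real.rpow_natCast, hN, pow_add]
        field_simp

/-- If a set `{L > T}` is connected, contains the centre of a ball and misses its boundary, it is
contained in the ball. -/
theorem le_of_isPreconnected_of_sphere {E : Type*} [SeminormedAddCommGroup E] {Ξ : Set E}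
    {L : E → ℝ} {a : E} {r T : ℝ} (hr : 0 < r) (ha : a ∈ Ξ) (hLa : T < L a)
    (hconn : IsPreconnected {ξ ∈ Ξ | T < L ξ}) (hsphere : ∀ ξ, dist ξ a = r → L ξ ≤ T)
    {ξ : E} (hξ : ξ ∈ Ξ) (hout : r ≤ dist ξ a) : L ξ ≤ T := by
  by_contra! hT
  have h1 := hconn.image (fun z => dist z a) (continuous_id.dist continuous_const).continuousOn
  obtain ⟨z, hz, hzr⟩ := h1.ordConnected.out (mem_image_of_mem _ ⟨ha, hLa⟩)
    (mem_image_of_mem _ ⟨hξ, hT⟩) (show r ∈ Icc (dist a a) (dist ξ a) from by simp [hr.le, hout])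
  exact absurd hz.2 (hsphere z hzr).not_gt

variable {d : ℕ} {Ξ : Set (EuclideanSpace ℝ (Fin d))} {π : EuclideanSpace ℝ (Fin d) → ℝ}
  {a : EuclideanSpace ℝ (Fin d)}

/-- Upper half of Laplace's method: the main part is a Gaussian integral at scale `s⁻¹`, and the
part outside the ball is exponentially small. -/
theorem exists_laplace_upper (hΞ : IsOpen Ξ) (hπ : IntegrableOn π Ξ) (hπ0 : ∀ ξ ∈ Ξ, 0 ≤ π ξ)
    {k : ℕ} {r M : ℝ} (hup : ∀ x, ‖x‖ ≤ r → π (a + x) ≤ M * ‖x‖ ^ k)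
    (A : ℝ) {lam δ : ℝ} (hlam : 0 < lam) (hδ : 0 < δ) :
    ∃ C : ℝ, ∀ s : ℝ, 1 ≤ s → ∀ L : EuclideanSpace ℝ (Fin d) → ℝ, ContinuousOn L Ξ →
      (∀ x, ‖x‖ ≤ r → L (a + x) ≤ A * s * ‖x‖ - lam * s ^ 2 * ‖x‖ ^ 2) →
      (∀ ξ ∈ Ξ, r < ‖ξ - a‖ → L ξ ≤ -(δ * s ^ 2)) →
      IntegrableOn (fun ξ => Real.exp (L ξ) * π ξ) Ξ ∧
        ∫ ξ in Ξ, Real.exp (L ξ) * π ξ ≤ C * (s⁻¹) ^ (d + k) := by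
  set F : EuclideanSpace ℝ (Fin d) → ℝ := fun u => ‖u‖ ^ k * Real.exp (-(lam / 2) * ‖u‖ ^ 2)
    with hF
  have hFi : Integrable F := integrable_norm_pow_mul_exp_neg_mul_sq volume k (half_pos hlam)
  set K := |M| * Real.exp (A ^ 2 / (2 * lam)) with hK
  set m := d + k with hm
  refine ⟨K * (∫ u, F u) + (m ! / δ ^ m) * ∫ ξ in Ξ, π ξ, fun s hs L hL hin hout => ?_⟩
  have hs0 : 0 < s := by linarith
  -- the Gaussian domination inside the ball, the exponential one outside
  set G : EuclideanSpace ℝ (Fin d) → ℝ := fun ξ => K * (s⁻¹) ^ k * F (s • (ξ - a)) with hG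
  have hG0 : ∀ ξ, 0 ≤ G ξ := fun ξ => by simp only [hG, hF, hK]; positivity
  have hGi : Integrable G :=
    ((hFi.comp_smul hs0.ne').comp_sub_right a).const_mul _
  have hdom : ∀ ξ ∈ Ξ, Real.exp (L ξ) * π ξ ≤ G ξ + Real.exp (-(δ * s ^ 2)) * π ξ := by
    intro ξ hξ
    by_cases hr : ‖ξ - a‖ ≤ r
    · have h1 := hin (ξ - a) hr
      have h2 := hup (ξ - a) hr
      rw [add_sub_cancel] at h1 h2
      set x := ‖ξ - a‖ with hx
      have hx0 : 0 ≤ x := norm_nonneg _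
      -- half of the quadratic term absorbs the linear one
      have h3 : A * s * x - lam * s ^ 2 * x ^ 2 ≤
          A ^ 2 / (2 * lam) + -(lam / 2) * (s * x) ^ 2 := by
        have : A ^ 2 / (2 * lam) + -(lam / 2) * (s * x) ^ 2 - (A * s * x - lam * s ^ 2 * x ^ 2) =
            lam / 2 * (s * x - A / lam) ^ 2 := by
          field_simp
          ring
        have : 0 ≤ lam / 2 * (s * x - A / lam) ^ 2 := by positivity
        linarith
      have h4 : Real.exp (L ξ) * π ξ ≤ G ξ := by
        calc Real.exp (L ξ) * π ξ
            ≤ Real.exp (A ^ 2 / (2 * lam) + -(lam / 2) * (s * x) ^ 2) * (|M| * x ^ k) := by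
              gcongr
              · exact hπ0 ξ hξ
              · exact h1.trans h3
              · exact h2.trans (by gcongr; exact le_abs_self M)
          _ = G ξ := by
              simp only [hG, hF, hK, norm_smul, Real.norm_of_nonneg hs0.le, ← hx]
              rw [Real.exp_add, mul_pow s x k, inv_pow]
              field_simp
      have h5 : 0 ≤ Real.exp (-(δ * s ^ 2)) * π ξ := mul_nonneg (Real.exp_pos _).le (hπ0 ξ hξ)
      linarith
    · have h1 := hout ξ hξ (not_le.1 hr)
      have h2 : Real.exp (L ξ) * π ξ ≤ Real.exp (-(δ * s ^ 2)) * π ξ := by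
        gcongr
        exact hπ0 ξ hξ
      linarith [hG0 ξ]
  have hRi : IntegrableOn (fun ξ => G ξ + Real.exp (-(δ * s ^ 2)) * π ξ) Ξ :=
    hGi.integrableOn.add (hπ.const_mul _)
  have hLi : IntegrableOn (fun ξ => Real.exp (L ξ) * π ξ) Ξ := by
    refine hRi.mono' ?_ ?_
    · exact ((Real.continuous_exp.comp_continuousOn hL).aestronglyMeasurable
        hΞ.measurableSet).mul hπ.aestronglyMeasurable
    · refine (ae_restrict_iff' hΞ.measurableSet).2 (Eventually.of_forall fun ξ hξ => ?_)
      rw [Real.norm_of_nonneg (mul_nonneg (Real.exp_pos _).le (hπ0 ξ hξ))]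
      exact hdom ξ hξ
  refine ⟨hLi, ?_⟩
  have hGint : ∫ ξ, G ξ = K * (∫ u, F u) * (s⁻¹) ^ m := by
    simp only [hG]
    rw [integral_const_mul, integral_sub_right_eq_self (fun x => F (s • x)) a,
      Measure.integral_comp_smul, finrank_euclideanSpace, Fintype.card_fin,
      abs_of_pos (by positivity), smul_eq_mul, hm, pow_add, inv_pow]
    ring
  have hexp : Real.exp (-(δ * s ^ 2)) ≤ m ! / δ ^ m * (s⁻¹) ^ m := by
    have h1 := Real.pow_div_factorial_le_exp (δ * s) (by positivity) m
    have h2 : 0 < (m ! : ℝ) := by exact_mod_cast m.factorial_pos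
    calc Real.exp (-(δ * s ^ 2)) ≤ Real.exp (-(δ * s)) := by
          rw [Real.exp_le_exp]
          nlinarith [mul_pos hδ hs0]
      _ ≤ ((δ * s) ^ m / m !)⁻¹ := by
          rw [Real.exp_neg]
          gcongr
      _ = m ! / δ ^ m * (s⁻¹) ^ m := by
          rw [inv_div, mul_pow, inv_pow]
          field_simp
  have hπI : 0 ≤ ∫ ξ in Ξ, π ξ := setIntegral_nonneg hΞ.measurableSet hπ0
  calc ∫ ξ in Ξ, Real.exp (L ξ) * π ξ
      ≤ ∫ ξ in Ξ, (G ξ + Real.exp (-(δ * s ^ 2)) * π ξ) :=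
        setIntegral_mono_on hLi hRi hΞ.measurableSet hdom
    _ = (∫ ξ in Ξ, G ξ) + Real.exp (-(δ * s ^ 2)) * ∫ ξ in Ξ, π ξ := by
        rw [integral_add hGi.integrableOn (hπ.const_mul _), integral_const_mul (Real.exp _)]
    _ ≤ (∫ ξ, G ξ) + (m ! / δ ^ m * (s⁻¹) ^ m) * ∫ ξ in Ξ, π ξ := by
        exact add_le_add (setIntegral_le_integral hGi (Eventually.of_forall hG0))
          (mul_le_mul_of_nonneg_right hexp hπI)
    _ = _ := by
        rw [hGint]
        ring

/-- Lower half of Laplace's method: the contribution of a small ball of radius of order `s⁻¹`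
in the cone where the prior is of exact order `k`. -/
theorem exists_laplace_lower (hΞ : IsOpen Ξ) (hπ0 : ∀ ξ ∈ Ξ, 0 ≤ π ξ)
    {k : ℕ} {r : ℝ} (hr : 0 < r) {u₀ : EuclideanSpace ℝ (Fin d)} {ρ c τ : ℝ} (hρ : 0 < ρ)
    (hc : 0 < c) (hτ : 0 < τ) (hlow : ∀ t : ℝ, 0 < t → t ≤ τ → ∀ u ∈ Metric.ball u₀ ρ,
      a + t • u ∈ Ξ ∧ c * t ^ k ≤ π (a + t • u))
    {A Lam : ℝ} (hA : 0 ≤ A) (hLam : 0 ≤ Lam) :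
    ∃ c' > 0, ∃ S : ℝ, ∀ s : ℝ, S ≤ s → ∀ L : EuclideanSpace ℝ (Fin d) → ℝ,
      IntegrableOn (fun ξ => Real.exp (L ξ) * π ξ) Ξ →
      (∀ x, ‖x‖ ≤ r → -(A * s * ‖x‖) - Lam * s ^ 2 * ‖x‖ ^ 2 ≤ L (a + x)) →
      c' * (s⁻¹) ^ (d + k) ≤ ∫ ξ in Ξ, Real.exp (L ξ) * π ξ := by
  set R := ‖u₀‖ + ρ with hR
  have hR0 : 0 < R := by positivity
  set V := volume.real (Metric.ball (0 : EuclideanSpace ℝ (Fin d)) ρ) with hV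
  have hV0 : 0 < V := ENNReal.toReal_pos (Metric.measure_ball_pos _ _ hρ).ne'
    measure_ball_lt_top.ne
  refine ⟨Real.exp (-(A * R) - Lam * R ^ 2) * c * V, by positivity, max 1 (max τ⁻¹ (R / r)),
    fun s hs L hLi hL => ?_⟩
  have hs0 : 0 < s := zero_lt_one.trans_le ((le_max_left _ _).trans hs)
  have hsτ : s⁻¹ ≤ τ := by
    rw [inv_le_comm₀ hs0 hτ]
    exact ((le_max_left _ _).trans (le_max_right _ _)).trans hs
  have hsr : s⁻¹ * R ≤ r := by
    have : R / r ≤ s := ((le_max_right _ _).trans (le_max_right _ _)).trans hs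
    rw [div_le_iff₀ hr] at this
    rw [inv_mul_le_iff₀ hs0]
    exact this
  -- the ball of centre `u₀` and radius `ρ` on the scale `t = s⁻¹`
  set t := s⁻¹ with ht
  have ht0 : 0 < t := inv_pos.2 hs0
  have hst : s * t = 1 := mul_inv_cancel₀ hs0.ne'
  set B := Metric.ball (a + t • u₀) (t * ρ) with hB
  have hBrep : ∀ ξ ∈ B, ∃ u ∈ Metric.ball u₀ ρ, ξ = a + t • u := by
    intro ξ hξ
    refine ⟨s • (ξ - a), ?_, ?_⟩
    · rw [Metric.mem_ball, dist_eq_norm] at hξ ⊢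
      have h1 : s • (ξ - a) - u₀ = s • (ξ - (a + t • u₀)) := by
        rw [← sub_sub, smul_sub _ (ξ - a), smul_smul, hst, one_smul]
      rw [h1, norm_smul, Real.norm_of_nonneg hs0.le]
      calc s * ‖ξ - (a + t • u₀)‖ < s * (t * ρ) := by gcongr
        _ = ρ := by rw [← mul_assoc, hst, one_mul]
    · rw [smul_smul, mul_comm t s, hst, one_smul, add_sub_cancel]
  have hBΞ : B ⊆ Ξ := fun ξ hξ => by
    obtain ⟨u, hu, rfl⟩ := hBrep ξ hξ
    exact (hlow t ht0 hsτ u hu).1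
  have hpt : ∀ ξ ∈ B, Real.exp (-(A * R) - Lam * R ^ 2) * (c * t ^ k) ≤
      Real.exp (L ξ) * π ξ := by
    intro ξ hξ
    obtain ⟨u, hu, rfl⟩ := hBrep ξ hξ
    have hun : ‖u‖ ≤ R := by
      have := norm_sub_norm_le u u₀
      rw [Metric.mem_ball, dist_eq_norm] at hu
      linarith
    have htu : ‖t • u‖ = t * ‖u‖ := by rw [norm_smul, Real.norm_of_nonneg ht0.le]
    have h1 := hL (t • u) (by rw [htu]; exact (by gcongr : t * ‖u‖ ≤ t * R).trans hsr)
    have h2 : -(A * s * ‖t • u‖) - Lam * s ^ 2 * ‖t • u‖ ^ 2 = -(A * ‖u‖) - Lam * ‖u‖ ^ 2 := by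
      rw [htu]
      calc _ = -(A * (s * t) * ‖u‖) - Lam * (s * t) ^ 2 * ‖u‖ ^ 2 := by ring
        _ = _ := by rw [hst]; ring
    rw [h2] at h1
    have h3 : -(A * R) - Lam * R ^ 2 ≤ -(A * ‖u‖) - Lam * ‖u‖ ^ 2 := by gcongr
    gcongr
    · exact h3.trans h1
    · exact (hlow t ht0 hsτ u hu).2
  have hvol : volume.real B = t ^ d * V := by
    rw [hB, hV, measureReal_def, measureReal_def, ← mul_one ρ, ← mul_assoc,
      Measure.addHaar_ball_mul_of_pos _ _ (by positivity),
      Measure.addHaar_ball_mul_of_pos _ _ hρ, finrank_euclideanSpace, Fintype.card_fin,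
      ENNReal.toReal_mul, ENNReal.toReal_mul, ENNReal.toReal_ofReal (by positivity),
      ENNReal.toReal_ofReal (by positivity), mul_pow]
    ring
  have h0 : ∀ ξ ∈ Ξ, 0 ≤ Real.exp (L ξ) * π ξ := fun ξ hξ =>
    mul_nonneg (Real.exp_pos _).le (hπ0 ξ hξ)
  calc Real.exp (-(A * R) - Lam * R ^ 2) * c * V * t ^ (d + k)
      = Real.exp (-(A * R) - Lam * R ^ 2) * (c * t ^ k) * volume.real B := by
        rw [hvol]; ring
    _ ≤ ∫ ξ in B, Real.exp (L ξ) * π ξ :=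
        setIntegral_ge_of_const_le_real Metric.isOpen_ball.measurableSet
          measure_ball_lt_top.ne hpt (hLi.mono_set hBΞ)
    _ ≤ ∫ ξ in Ξ, Real.exp (L ξ) * π ξ :=
        setIntegral_mono_set hLi ((ae_restrict_iff' hΞ.measurableSet).2
          (Eventually.of_forall h0)) (LE.le.eventuallyLE hBΞ)

/-- **Laplace's method** with uniform constants: if `L` lies between two quadratic functions at
scale `s⁻¹` near its reference point `a`, and has connected upper level sets, then the integral of
`exp L` against a density of exact order `k` at `a` is of exact order `s ^ (-(d + k))`. -/
theorem exists_laplace_bound (hΞ : IsOpen Ξ) (hπ : IntegrableOn π Ξ) (hπ0 : ∀ ξ ∈ Ξ, 0 ≤ π ξ)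
    {k : ℕ} {r M : ℝ} (hr : 0 < r) (hup : ∀ x, ‖x‖ ≤ r → a + x ∈ Ξ ∧ π (a + x) ≤ M * ‖x‖ ^ k)
    {u₀ : EuclideanSpace ℝ (Fin d)} {ρ c τ : ℝ} (hρ : 0 < ρ)
    (hc : 0 < c) (hτ : 0 < τ) (hlow : ∀ t : ℝ, 0 < t → t ≤ τ → ∀ u ∈ Metric.ball u₀ ρ,
      a + t • u ∈ Ξ ∧ c * t ^ k ≤ π (a + t • u))
    {A lam Lam : ℝ} (hA : 0 ≤ A) (hlam : 0 < lam) (hLam : 0 ≤ Lam) :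
    ∃ C S : ℝ, ∀ s : ℝ, S ≤ s → ∀ L : EuclideanSpace ℝ (Fin d) → ℝ, ContinuousOn L Ξ → L a = 0 →
      (∀ x, ‖x‖ ≤ r → L (a + x) ≤ A * s * ‖x‖ - lam * s ^ 2 * ‖x‖ ^ 2) →
      (∀ x, ‖x‖ ≤ r → -(A * s * ‖x‖) - Lam * s ^ 2 * ‖x‖ ^ 2 ≤ L (a + x)) →
      (∀ T : ℝ, IsPreconnected {ξ ∈ Ξ | T < L ξ}) →
      0 < ∫ ξ in Ξ, Real.exp (L ξ) * π ξ ∧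
      |Real.log (∫ ξ in Ξ, Real.exp (L ξ) * π ξ) + ((d : ℝ) + k) * Real.log s| ≤ C := by
  have hδ : 0 < lam * r ^ 2 / 2 := by positivity
  obtain ⟨C, hC⟩ := exists_laplace_upper hΞ hπ hπ0 (fun x hx => (hup x hx).2) A hlam hδ
  obtain ⟨c', hc', S, hS⟩ := exists_laplace_lower hΞ hπ0 hr hρ hc hτ hlow hA hLam
  refine ⟨max |Real.log c'| |Real.log C|, max (max 1 S) (2 * A / (lam * r)),
    fun s hs L hLc hLa hLup hLlow hconn => ?_⟩
  have hs1 : 1 ≤ s := ((le_max_left _ _).trans (le_max_left _ _)).trans hs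
  have hsS : S ≤ s := ((le_max_right _ _).trans (le_max_left _ _)).trans hs
  have hsA : 2 * A / (lam * r) ≤ s := (le_max_right _ _).trans hs
  have hs0 : 0 < s := by linarith
  have ha : a ∈ Ξ := by simpa using (hup 0 (by simpa using hr.le)).1
  -- on the sphere of radius `r` the quadratic term is at least twice the linear one
  have hsphere : ∀ ξ, dist ξ a = r → L ξ ≤ -(lam * r ^ 2 / 2 * s ^ 2) := by
    intro ξ hξ
    rw [dist_eq_norm] at hξ
    have h1 := hLup (ξ - a) hξ.le
    rw [add_sub_cancel, hξ] at h1
    rw [div_le_iff₀ (by positivity)] at hsA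
    have h2 : 2 * A * (s * r) ≤ s * (lam * r) * (s * r) := by gcongr
    nlinarith
  have hout : ∀ ξ ∈ Ξ, r < ‖ξ - a‖ → L ξ ≤ -(lam * r ^ 2 / 2 * s ^ 2) := fun ξ hξ h =>
    le_of_isPreconnected_of_sphere hr ha (by rw [hLa]; have := mul_pos hδ (pow_pos hs0 2); linarith)
      (hconn _) hsphere hξ (by rw [dist_eq_norm]; exact h.le)
  obtain ⟨hi, h1⟩ := hC s hs1 L hLc hLup hout
  have h2 := hS s hsS L hi hLlow
  set I := ∫ ξ in Ξ, Real.exp (L ξ) * π ξ with hI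
  have ht : 0 < (s⁻¹) ^ (d + k) := by positivity
  have hI0 : 0 < I := lt_of_lt_of_le (by positivity) h2
  have hC0 : 0 < C := by
    by_contra! hneg
    exact absurd (h1.trans (mul_nonpos_of_nonpos_of_nonneg hneg ht.le)) hI0.not_ge
  refine ⟨hI0, ?_⟩
  have hlog : Real.log ((s⁻¹) ^ (d + k)) = -(((d : ℝ) + k) * Real.log s) := by
    rw [Real.log_pow, Real.log_inv]
    push_cast
    ring
  have h3 := Real.log_le_log hI0 h1
  have h4 := Real.log_le_log (by positivity) h2
  rw [Real.log_mul hC0.ne' ht.ne', hlog] at h3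
  rw [Real.log_mul hc'.ne' ht.ne', hlog] at h4
  rw [abs_le]
  constructor
  · have := neg_abs_le (Real.log c')
    have := le_max_left |Real.log c'| |Real.log C|
    linarith
  · have := le_abs_self (Real.log C)
    have := le_max_right |Real.log c'| |Real.log C|
    linarith

end Laplace
end MomentPrior

namespace MomentPrior
open Topology Set

/-! ### Divergences and laws of densities -/

section Densities

theorem jointDensity_pos {Y : Type*} {q : Y → ℝ} (hq : ∀ y, 0 < q y) {n : ℕ} (y : Fin n → Y) :
    0 < jointDensity q y :=
  Finset.prod_pos fun i _ => hq (y i)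

variable {Y : Type*} [MeasurableSpace Y] {μ : Measure Y} {q f : Y → ℝ}

theorem IsPosDensity.isProbabilityMeasure_law (hq : IsPosDensity μ q) :
    IsProbabilityMeasure (law μ q) :=
  ⟨by rw [law, withDensity_apply _ MeasurableSet.univ, Measure.restrict_univ,
    hq.lintegral_eq_one]⟩

theorem law_absolutelyContinuous : law μ q ≪ μ := withDensity_absolutelyContinuous _ _

theorem IsPosDensity.absolutelyContinuous_law (hf : IsPosDensity μ f) : μ ≪ law μ f :=
  withDensity_absolutelyContinuous' hf.measurable.ennreal_ofReal.aemeasurable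
    (Eventually.of_forall fun y => by simpa using hf.pos y)

theorem llr_law_ae_eq [SigmaFinite μ] (hq : IsPosDensity μ q) (hf : IsPosDensity μ f) :
    llr (law μ q) (law μ f) =ᵐ[law μ q] fun y => Real.log (q y / f y) := by
  have := hq.isProbabilityMeasure_law
  have h1 := Measure.rnDeriv_withDensity_right (law μ q) μ
    (f := fun y => ENNReal.ofReal (f y)) hf.measurable.ennreal_ofReal.aemeasurable
    (Eventually.of_forall fun y => by simpa using hf.pos y)
    (Eventually.of_forall fun y => ENNReal.ofReal_ne_top)
  have h2 := Measure.rnDeriv_withDensity μ hq.measurable.ennreal_ofReal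
  filter_upwards [law_absolutelyContinuous.ae_le h1, law_absolutelyContinuous.ae_le h2]
    with y hy1 hy2
  rw [llr, show law μ f = μ.withDensity fun y => ENNReal.ofReal (f y) from rfl, hy1,
    show law μ q = μ.withDensity fun y => ENNReal.ofReal (q y) from rfl, hy2,
    ENNReal.toReal_mul, ENNReal.toReal_inv, ENNReal.toReal_ofReal (hq.pos y).le,
    ENNReal.toReal_ofReal (hf.pos y).le, inv_mul_eq_div]

/-- The divergence between positive densities is the expected log-ratio, as soon as the latter is
integrable. -/
theorem kl_ne_top_and_toReal_eq [SigmaFinite μ] (hq : IsPosDensity μ q) (hf : IsPosDensity μ f)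
    (hint : Integrable (fun y => Real.log (q y / f y)) (law μ q)) :
    kl μ q f ≠ ⊤ ∧ (kl μ q f).toReal = ∫ y, Real.log (q y / f y) ∂(law μ q) := by
  have := hq.isProbabilityMeasure_law
  have := hf.isProbabilityMeasure_law
  have hac : law μ q ≪ law μ f := law_absolutelyContinuous.trans hf.absolutelyContinuous_law
  have hllr := llr_law_ae_eq hq hf
  refine ⟨InformationTheory.klDiv_ne_top hac (hint.congr hllr.symm), ?_⟩
  rw [kl, InformationTheory.toReal_klDiv_of_measure_eq hac (by simp), integral_congr_ae hllr]

theorem kl_eq_zero_of_ae_eq [SigmaFinite μ] (hq : IsPosDensity μ q) (h : f =ᵐ[μ] q) :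
    kl μ q f = 0 := by
  have := hq.isProbabilityMeasure_law
  have : law μ f = law μ q :=
    withDensity_congr_ae (h.mono fun y hy => congrArg ENNReal.ofReal hy)
  rw [kl, this, InformationTheory.klDiv_self]

/-- A finite extended variance entails square integrability, hence an integrable log-ratio and a
finite divergence. -/
theorem memLp_two_log_ratio (hq : IsPosDensity μ q) (hf : IsPosDensity μ f)
    (hvar : ProbabilityTheory.evariance (fun y => Real.log (q y / f y)) (law μ q) < ⊤) :
    MemLp (fun y => Real.log (q y / f y)) 2 (law μ q) := by
  have := hq.isProbabilityMeasure_law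
  exact (ProbabilityTheory.evariance_lt_top_iff_memLp
    (hq.measurable.div hf.measurable).log.aestronglyMeasurable).1 hvar

end Densities

/-! ### Sums over an i.i.d. sample -/

section Stochastic

variable {Ω Y : Type*} [MeasurableSpace Ω] [MeasurableSpace Y] {P : Measure Ω}
  {μ : Measure Y} {q : Y → ℝ} {y : ℕ → Ω → Y}

theorem IsIIDSample.integral_comp (hy : IsIIDSample P y μ q) (i : ℕ) {φ : Y → ℝ}
    (hφ : Measurable φ) : ∫ ω, φ (y i ω) ∂P = ∫ z, φ z ∂(law μ q) := by
  rw [← hy.map_eq i, integral_map (hy.measurable i).aemeasurable hφ.aestronglyMeasurable]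

theorem IsIIDSample.memLp_comp (hy : IsIIDSample P y μ q) (i : ℕ) {φ : Y → ℝ} {r : ℝ≥0∞}
    (hφ : MemLp φ r (law μ q)) : MemLp (fun ω => φ (y i ω)) r P := by
  rw [← hy.map_eq i] at hφ
  exact hφ.comp_of_map (hy.measurable i).aemeasurable

theorem IsIIDSample.identDistrib_comp (hy : IsIIDSample P y μ q) (i : ℕ) {φ : Y → ℝ}
    (hφ : Measurable φ) :
    ProbabilityTheory.IdentDistrib (fun ω => φ (y i ω)) (fun ω => φ (y 0 ω)) P P :=
  ProbabilityTheory.IdentDistrib.comp (u := φ)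
    ⟨(hy.measurable i).aemeasurable, (hy.measurable 0).aemeasurable,
      by rw [hy.map_eq, hy.map_eq]⟩ hφ

theorem IsIIDSample.pairwise_indepFun (hy : IsIIDSample P y μ q) {φ : Y → ℝ}
    (hφ : Measurable φ) : Pairwise fun i j =>
      ProbabilityTheory.IndepFun (fun ω => φ (y i ω)) (fun ω => φ (y j ω)) P := fun _ _ hij =>
  (hy.indep.indepFun hij).comp hφ hφ

/-- Chebyshev's inequality for sums of independent observations: the centred sums are of order
`√n` in probability. -/
theorem IsIIDSample.isBigOp_sum [IsProbabilityMeasure P] (hy : IsIIDSample P y μ q) {φ : Y → ℝ}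
    (hφ : Measurable φ) (hφ2 : MemLp φ 2 (law μ q)) :
    IsBigOp P (fun n ω => ∑ i : Fin n, φ (y i ω) - n * ∫ z, φ z ∂(law μ q))
      (fun n => (n : ℝ) ^ (1 / 2 : ℝ)) := by
  intro ε hε
  set V := ProbabilityTheory.variance (fun ω => φ (y 0 ω)) P with hV
  have hV0 : 0 ≤ V := ProbabilityTheory.variance_nonneg _ _
  set C := Real.sqrt ((V + 1) / ε) with hC
  have hC0 : 0 < C := by positivity
  have hC2 : C ^ 2 = (V + 1) / ε := Real.sq_sqrt (by positivity)
  refine ⟨C, ?_⟩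
  filter_upwards [eventually_ge_atTop 1] with n hn
  have hn0 : (0 : ℝ) < n := by exact_mod_cast hn
  set X : Ω → ℝ := ∑ i ∈ Finset.range n, fun ω => φ (y i ω) with hX
  have hXapp : ∀ ω, X ω = ∑ i : Fin n, φ (y i ω) := fun ω => by
    rw [hX, Finset.sum_apply, Finset.sum_range]
  have hXL : MemLp X 2 P := memLp_finsetSum' _ fun i _ => hy.memLp_comp i hφ2
  have hXE : ∫ ω, X ω ∂P = n * ∫ z, φ z ∂(law μ q) := by
    simp only [hX, Finset.sum_apply]
    rw [integral_finsetSum _ fun i _ => (hy.memLp_comp i hφ2).integrable (by norm_num)]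
    simp [hy.integral_comp _ hφ]
  have hXV : ProbabilityTheory.variance X P = n * V := by
    rw [hX, ProbabilityTheory.IndepFun.variance_sum (fun i _ => hy.memLp_comp i hφ2)
      fun i _ j _ hij => hy.pairwise_indepFun hφ hij]
    rw [Finset.sum_congr rfl fun i _ => (hy.identDistrib_comp i hφ).variance_eq]
    simp [hV]
  have hsq : ((n : ℝ) ^ (1 / 2 : ℝ)) ^ 2 = n := by
    rw [← Real.sqrt_eq_rpow, Real.sq_sqrt hn0.le]
  have hpos : 0 < C * (n : ℝ) ^ (1 / 2 : ℝ) := by positivity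
  have h1 := ProbabilityTheory.meas_ge_le_variance_div_sq hXL hpos
  rw [hXE, hXV, mul_pow, hsq, hC2] at h1
  refine (measure_mono fun ω hω => ?_).trans (h1.trans (ENNReal.ofReal_le_ofReal ?_))
  · rw [mem_ofPred_eq] at hω ⊢
    rw [hXapp]
    exact hω.le
  · rw [div_mul_eq_mul_div, div_div_eq_mul_div, div_le_iff₀ (by positivity)]
    nlinarith [mul_pos hε hn0]

/-- The weak law of large numbers for functions of the observations. -/
theorem IsIIDSample.tendsto_measure_average [IsProbabilityMeasure P] (hy : IsIIDSample P y μ q)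
    {φ : Y → ℝ} (hφ : Measurable φ) (hφ1 : Integrable φ (law μ q)) {η : ℝ} (hη : 0 < η) :
    Tendsto (fun n : ℕ => P {ω | η * n < |∑ i : Fin n, φ (y i ω) - n * ∫ z, φ z ∂(law μ q)|})
      atTop (𝓝 0) := by
  have hint : Integrable (fun ω => φ (y 0 ω)) P :=
    memLp_one_iff_integrable.1 (hy.memLp_comp 0 (memLp_one_iff_integrable.2 hφ1))
  have h1 := ProbabilityTheory.strong_law_ae_real (fun i ω => φ (y i ω)) hint
    (hy.pairwise_indepFun hφ) fun i => hy.identDistrib_comp i hφ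
  have h2 : TendstoInMeasure P (fun (n : ℕ) ω => (∑ i ∈ Finset.range n, φ (y i ω)) / n) atTop
      fun _ => ∫ ω, φ (y 0 ω) ∂P :=
    tendstoInMeasure_of_tendsto_ae (fun n => ((Finset.measurable_sum _ fun i _ =>
      hφ.comp (hy.measurable i)).div_const _).aestronglyMeasurable) h1
  have h3 := tendstoInMeasure_iff_dist.1 h2 η hη
  refine tendsto_of_tendsto_of_tendsto_of_le_of_le' tendsto_const_nhds h3
    (Eventually.of_forall fun _ => zero_le) ?_
  filter_upwards [eventually_ge_atTop 1] with n hn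
  have hn0 : (0 : ℝ) < n := by exact_mod_cast hn
  refine measure_mono fun ω hω => ?_
  rw [mem_ofPred_eq] at hω ⊢
  rw [Real.dist_eq, hy.integral_comp 0 hφ, Finset.sum_range, div_sub' hn0.ne', abs_div,
    abs_of_pos hn0, le_div_iff₀ hn0]
  exact hω.le

/-- Markov's inequality for sums of nonnegative functions of the observations. -/
theorem IsIIDSample.measure_lt_sum_le (hy : IsIIDSample P y μ q) {W : Y → ℝ≥0∞}
    (hW : Measurable W) {η : ℝ} (hη : 0 < η) {n : ℕ} (hn : 1 ≤ n) :
    P {ω | ENNReal.ofReal (η * n) < ∑ i : Fin n, W (y i ω)} ≤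
      (∫⁻ z, W z ∂(law μ q)) / ENNReal.ofReal η := by
  have hn0 : (0 : ℝ) < n := by exact_mod_cast hn
  have hWi : ∀ i, Measurable fun ω => W (y i ω) := fun i => hW.comp (hy.measurable i)
  have h1 := meas_ge_le_lintegral_div (μ := P) (f := fun ω => ∑ i : Fin n, W (y i ω))
    (Finset.measurable_sum _ fun i _ => hWi _).aemeasurable
    (ε := ENNReal.ofReal (η * n)) (by simpa using mul_pos hη hn0) ENNReal.ofReal_ne_top
  refine (measure_mono fun ω hω => ?_).trans (h1.trans (le_of_eq ?_))
  · rw [mem_ofPred_eq] at hω ⊢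
    exact hω.le
  rw [lintegral_finsetSum _ fun i _ => hWi _]
  have h2 : ∀ i : Fin n, ∫⁻ ω, W (y i ω) ∂P = ∫⁻ z, W z ∂(law μ q) := fun i => by
    rw [← hy.map_eq i, lintegral_map hW (hy.measurable i)]
  simp only [h2, Finset.sum_const, Finset.card_univ, Fintype.card_fin, nsmul_eq_mul]
  rw [ENNReal.ofReal_mul hη.le, ENNReal.ofReal_natCast, mul_comm (n : ℝ≥0∞),
    ENNReal.mul_div_mul_right _ _ (by simp; omega) (by simp)]

end Stochastic
end MomentPrior

/-! ### Second-order expansions and measurability of the score and the Hessian -/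

namespace MomentPrior
open Topology Set

section SecondOrder

variable {d : ℕ} {Ξ : Set (EuclideanSpace ℝ (Fin d))} {ℓ : EuclideanSpace ℝ (Fin d) → ℝ}
  {a : EuclideanSpace ℝ (Fin d)}

/-- The remainder of the second-order Taylor expansion of `ℓ` at `a`, as a function of the
displacement `x`. -/
noncomputable def quadRem (ℓ : EuclideanSpace ℝ (Fin d) → ℝ) (a x : EuclideanSpace ℝ (Fin d)) : ℝ :=
  ℓ (a + x) - ℓ a - fderiv ℝ ℓ a x - hess ℓ a x x / 2

theorem hess_smul_smul (z x : EuclideanSpace ℝ (Fin d)) (t : ℝ) :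
    hess ℓ z (t • x) (t • x) = t ^ 2 * hess ℓ z x x := by
  simp [hess, pow_two, mul_assoc]

theorem sum_apply_smul_single (x : EuclideanSpace ℝ (Fin d)) :
    ∑ i, x i • EuclideanSpace.single i (1 : ℝ) = x := by
  simpa using (EuclideanSpace.basisFun (Fin d) ℝ).sum_repr x

theorem hess_eq_sum (z x w : EuclideanSpace ℝ (Fin d)) :
    hess ℓ z x w = ∑ i, ∑ j, x i * w j *
      hess ℓ z (EuclideanSpace.single i 1) (EuclideanSpace.single j 1) := by
  conv_lhs => rw [← sum_apply_smul_single x, ← sum_apply_smul_single w]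
  simp only [hess, map_sum, map_smul, sum_apply,
    smul_apply, smul_eq_mul, Finset.mul_sum]
  rw [Finset.sum_comm]
  exact Finset.sum_congr rfl fun i _ => Finset.sum_congr rfl fun j _ => by ring

theorem abs_quadForm_le {h : Fin d → Fin d → ℝ} {c : ℝ} (hc : ∀ i j, |h i j| ≤ c)
    (x : EuclideanSpace ℝ (Fin d)) :
    |∑ i, ∑ j, x i * x j * h i j| ≤ d ^ 2 * c * ‖x‖ ^ 2 := by
  have hx : ∀ i, |x i| ≤ ‖x‖ := fun i => PiLp.norm_apply_le x i
  have h1 : ∀ i j, |x i * x j * h i j| ≤ ‖x‖ * ‖x‖ * c := fun i j => by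
    rw [abs_mul, abs_mul]
    have hc0 : 0 ≤ c := (abs_nonneg _).trans (hc i j)
    gcongr
    · exact hx i
    · exact hx j
    · exact hc i j
  calc |∑ i, ∑ j, x i * x j * h i j| ≤ ∑ i, ∑ j, |x i * x j * h i j| :=
        (Finset.abs_sum_le_sum_abs _ _).trans
          (Finset.sum_le_sum fun i _ => Finset.abs_sum_le_sum_abs _ _)
    _ ≤ ∑ _i : Fin d, ∑ _j : Fin d, ‖x‖ * ‖x‖ * c :=
        Finset.sum_le_sum fun i _ => Finset.sum_le_sum fun j _ => h1 i j
    _ = d ^ 2 * c * ‖x‖ ^ 2 := by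
        simp only [Finset.sum_const, Finset.card_univ, Fintype.card_fin, nsmul_eq_mul]
        ring

theorem exists_taylor_two (hΞ : IsOpen Ξ) (hℓ : ContDiffOn ℝ 2 ℓ Ξ) {r : ℝ}
    (hr : Metric.ball a r ⊆ Ξ) {x : EuclideanSpace ℝ (Fin d)} (hx : ‖x‖ < r) :
    ∃ t ∈ Icc (0 : ℝ) 1, a + t • x ∈ Metric.ball a r ∧
      ℓ (a + x) = ℓ a + fderiv ℝ ℓ a x + hess ℓ (a + t • x) x x / 2 := by
  have hin : ∀ t ∈ Icc (0 : ℝ) 1, a + t • x ∈ Metric.ball a r := fun t ht => by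
    rw [Metric.mem_ball, dist_self_add_left]
    exact (norm_smul_le_of_mem_Icc ht x).trans_lt hx
  obtain ⟨t, ht, h⟩ := exists_taylor_segment hΞ (k := 2) hℓ a x fun t ht => hr (hin t ht)
  refine ⟨t, ht, hin t ht, ?_⟩
  rw [h]
  simp [Finset.sum_range_succ, iteratedFDeriv_two_apply, hess]
  ring

theorem hess_eq_iteratedFDeriv (z x : EuclideanSpace ℝ (Fin d)) :
    hess ℓ z x x = iteratedFDeriv ℝ 2 ℓ z fun _ => x := by
  rw [iteratedFDeriv_two_apply, hess]

theorem abs_quadRem_le (hΞ : IsOpen Ξ) (hℓ : ContDiffOn ℝ 2 ℓ Ξ) {r c : ℝ}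
    (hr : Metric.ball a r ⊆ Ξ) (hc : ∀ ξ ∈ Metric.ball a r, ∀ i j : Fin d,
      |hess ℓ ξ (EuclideanSpace.single i 1) (EuclideanSpace.single j 1)| ≤ c)
    {x : EuclideanSpace ℝ (Fin d)} (hx : ‖x‖ < r) :
    |quadRem ℓ a x| ≤ d ^ 2 * c * ‖x‖ ^ 2 := by
  obtain ⟨t, ht, hmem, h⟩ := exists_taylor_two hΞ hℓ hr hx
  have h1 : |hess ℓ (a + t • x) x x| ≤ d ^ 2 * c * ‖x‖ ^ 2 := by
    rw [hess_eq_sum]; exact abs_quadForm_le (hc _ hmem) x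
  have h2 : |hess ℓ a x x| ≤ d ^ 2 * c * ‖x‖ ^ 2 := by
    rw [hess_eq_sum]
    exact abs_quadForm_le (hc _ (Metric.mem_ball_self ((norm_nonneg x).trans_lt hx))) x
  have h3 : quadRem ℓ a x = hess ℓ (a + t • x) x x / 2 - hess ℓ a x x / 2 := by
    rw [quadRem, h]; ring
  rw [h3]
  rw [abs_le] at h1 h2 ⊢
  constructor <;> linarith [h1.1, h1.2, h2.1, h2.2]

theorem exists_abs_quadRem_le (hΞ : IsOpen Ξ) (hℓ : ContDiffOn ℝ 2 ℓ Ξ) (ha : a ∈ Ξ)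
    {ε : ℝ} (hε : 0 < ε) :
    ∃ r > 0, ∀ x, ‖x‖ < r → |quadRem ℓ a x| ≤ ε * ‖x‖ ^ 2 := by
  have hc : ContinuousAt (iteratedFDeriv ℝ 2 ℓ) a :=
    (hℓ.contDiffAt (hΞ.mem_nhds ha)).continuousAt_iteratedFDeriv (by norm_num)
  have h0 : Tendsto (fun z => ‖iteratedFDeriv ℝ 2 ℓ z - iteratedFDeriv ℝ 2 ℓ a‖) (𝓝 a) (𝓝 0) := by
    have := (hc.sub (continuousAt_const (y := iteratedFDeriv ℝ 2 ℓ a))).norm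
    simpa [ContinuousAt] using this
  obtain ⟨r₁, hr₁, h1⟩ := Metric.eventually_nhds_iff.1 (h0.eventually (gt_mem_nhds hε))
  obtain ⟨r₂, hr₂, h2⟩ := Metric.isOpen_iff.1 hΞ a ha
  refine ⟨min r₁ r₂, lt_min hr₁ hr₂, fun x hx => ?_⟩
  obtain ⟨t, ht, hmem, h⟩ := exists_taylor_two hΞ hℓ
    ((Metric.ball_subset_ball (min_le_right _ _)).trans h2) hx
  have h3 : quadRem ℓ a x =
      (iteratedFDeriv ℝ 2 ℓ (a + t • x) - iteratedFDeriv ℝ 2 ℓ a) (fun _ => x) / 2 := by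
    rw [quadRem, h, hess_eq_iteratedFDeriv, hess_eq_iteratedFDeriv, sub_apply]
    ring
  have h4 := h1 (Metric.ball_subset_ball (min_le_left _ _) hmem)
  have h5 : ‖(iteratedFDeriv ℝ 2 ℓ (a + t • x) - iteratedFDeriv ℝ 2 ℓ a) (fun _ => x)‖ ≤
      ε * ‖x‖ ^ 2 := by
    refine ((iteratedFDeriv ℝ 2 ℓ (a + t • x) - iteratedFDeriv ℝ 2 ℓ a).le_opNorm _).trans ?_
    rw [Finset.prod_const, Finset.card_univ, Fintype.card_fin]
    gcongr
  rw [Real.norm_eq_abs] at h5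
  rw [h3, abs_div, abs_two]
  have : 0 ≤ ε * ‖x‖ ^ 2 := by positivity
  linarith

end SecondOrder

section Measurability

variable {Y : Type*} [MeasurableSpace Y] {d : ℕ} {Ξ : Set (EuclideanSpace ℝ (Fin d))}
  {f : EuclideanSpace ℝ (Fin d) → Y → ℝ} {a : EuclideanSpace ℝ (Fin d)}

/-- A sequence of nonzero step sizes tending to zero along which `a + t • v` stays in `Ξ`. -/
theorem exists_seq_add_smul_mem (hΞ : IsOpen Ξ) (ha : a ∈ Ξ) (v : EuclideanSpace ℝ (Fin d)) :
    ∃ t : ℕ → ℝ, (∀ n, t n ≠ 0) ∧ Tendsto t atTop (𝓝 0) ∧ ∀ n, a + t n • v ∈ Ξ := by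
  have h1 : Tendsto (fun t : ℝ => a + t • v) (𝓝 0) (𝓝 a) := by
    have : Continuous fun t : ℝ => a + t • v := by fun_prop
    simpa using this.tendsto 0
  have h2 : ∀ᶠ n : ℕ in atTop, a + (1 / ((n : ℝ) + 1)) • v ∈ Ξ :=
    (h1.comp tendsto_one_div_add_atTop_nhds_zero_nat).eventually (hΞ.mem_nhds ha)
  obtain ⟨N, hN⟩ := eventually_atTop.1 h2
  refine ⟨fun n => 1 / (((n + N : ℕ) : ℝ) + 1), fun n => by positivity, ?_,
    fun n => hN _ (Nat.le_add_left _ _)⟩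
  exact tendsto_one_div_add_atTop_nhds_zero_nat.comp (tendsto_add_atTop_nat N)

/-- The score is measurable in the observation, as a limit of difference quotients. -/
theorem measurable_fderiv_logLik (hΞ : IsOpen Ξ) (ha : a ∈ Ξ)
    (hm : ∀ ξ ∈ Ξ, Measurable fun y => logLik f y ξ)
    (hd : ∀ y, DifferentiableAt ℝ (logLik f y) a) (v : EuclideanSpace ℝ (Fin d)) :
    Measurable fun y => fderiv ℝ (logLik f y) a v := by
  obtain ⟨t, ht0, ht, htΞ⟩ := exists_seq_add_smul_mem hΞ ha v
  refine measurable_of_tendsto_metrizable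
    (f := fun n y => (t n)⁻¹ • (logLik f y (a + t n • v) - logLik f y a))
    (fun n => ((hm _ (htΞ n)).sub (hm a ha)).const_smul (t n)⁻¹) (tendsto_pi_nhds.2 fun y => ?_)
  have h1 : HasDerivAt (fun s : ℝ => logLik f y (a + s • v)) (fderiv ℝ (logLik f y) a v) 0 := by
    have hl : HasDerivAt (fun u : ℝ => a + u • v) v 0 := by
      simpa using ((hasDerivAt_id (0 : ℝ)).smul_const v).const_add a
    have h2 : HasFDerivAt (logLik f y) (fderiv ℝ (logLik f y) a) (a + (0 : ℝ) • v) := by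
      simpa using (hd y).hasFDerivAt
    exact h2.comp_hasDerivAt 0 hl
  have h3 := h1.tendsto_slope_zero.comp
    (tendsto_nhdsWithin_iff.2 ⟨ht, Eventually.of_forall ht0⟩)
  simpa [Function.comp_def] using h3

/-- The quadratic form of the Hessian is measurable in the observation, as a limit of normalized
first-order Taylor remainders. -/
theorem measurable_hess_diag (hΞ : IsOpen Ξ) (ha : a ∈ Ξ)
    (hm : ∀ ξ ∈ Ξ, Measurable fun y => logLik f y ξ)
    (hd : ∀ y, ContDiffOn ℝ 2 (logLik f y) Ξ) (v : EuclideanSpace ℝ (Fin d)) :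
    Measurable fun y => hess (logLik f y) a v v := by
  obtain ⟨t, ht0, ht, htΞ⟩ := exists_seq_add_smul_mem hΞ ha v
  have hdiff : ∀ y, DifferentiableAt ℝ (logLik f y) a := fun y =>
    ((hd y).contDiffAt (hΞ.mem_nhds ha)).differentiableAt (by norm_num)
  refine measurable_of_tendsto_metrizable
    (f := fun n y => 2 / t n ^ 2 * (logLik f y (a + t n • v) - logLik f y a -
      t n * fderiv ℝ (logLik f y) a v))
    (fun n => (((hm _ (htΞ n)).sub (hm a ha)).sub
      ((measurable_fderiv_logLik hΞ ha hm hdiff v).const_mul _)).const_mul _)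
    (tendsto_pi_nhds.2 fun y => ?_)
  rw [Metric.tendsto_atTop]
  intro ε hε
  obtain ⟨r, hr, hrem⟩ := exists_abs_quadRem_le hΞ (hd y) ha
    (ε := ε / (4 * (‖v‖ + 1) ^ 2)) (by positivity)
  have h1 : Tendsto (fun n => t n • v) atTop (𝓝 0) := by simpa using ht.smul_const v
  obtain ⟨N, hN⟩ := Metric.tendsto_atTop.1 h1 r hr
  refine ⟨N, fun n hn => ?_⟩
  have h2 := hrem (t n • v) (by simpa using hN n hn)
  have htn := ht0 n
  have h3 : 2 / t n ^ 2 * (logLik f y (a + t n • v) - logLik f y a -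
      t n * fderiv ℝ (logLik f y) a v) - hess (logLik f y) a v v =
      2 / t n ^ 2 * quadRem (logLik f y) a (t n • v) := by
    rw [quadRem, hess_smul_smul, map_smul, smul_eq_mul]
    field_simp
  rw [Real.dist_eq, h3, abs_mul, abs_of_nonneg (by positivity : 0 ≤ 2 / t n ^ 2)]
  rw [norm_smul, mul_pow, Real.norm_eq_abs, sq_abs] at h2
  calc 2 / t n ^ 2 * |quadRem (logLik f y) a (t n • v)|
      ≤ 2 / t n ^ 2 * (ε / (4 * (‖v‖ + 1) ^ 2) * (t n ^ 2 * ‖v‖ ^ 2)) := by gcongr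
    _ = ε / 2 * (‖v‖ ^ 2 / (‖v‖ + 1) ^ 2) := by field_simp; norm_num
    _ ≤ ε / 2 * 1 := by
        gcongr
        rw [div_le_one (by positivity)]
        gcongr
        linarith
    _ < ε := by linarith

theorem measurable_hess (hΞ : IsOpen Ξ) (ha : a ∈ Ξ)
    (hm : ∀ ξ ∈ Ξ, Measurable fun y => logLik f y ξ)
    (hd : ∀ y, ContDiffOn ℝ 2 (logLik f y) Ξ) (v w : EuclideanSpace ℝ (Fin d)) :
    Measurable fun y => hess (logLik f y) a v w := by
  have h1 : (fun y => hess (logLik f y) a v w) = fun y => (hess (logLik f y) a (v + w) (v + w) -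
      hess (logLik f y) a v v - hess (logLik f y) a w w) / 2 := by
    funext y
    have hsymm : hess (logLik f y) a w v = hess (logLik f y) a v w :=
      (((hd y).contDiffAt (hΞ.mem_nhds ha)).isSymmSndFDerivAt (by simp)).eq w v
    have hexp : hess (logLik f y) a (v + w) (v + w) = hess (logLik f y) a v v +
        hess (logLik f y) a v w + (hess (logLik f y) a w v + hess (logLik f y) a w w) := by
      simp only [hess, map_add, add_apply]
      ring
    rw [hexp, hsymm]
    ring
  rw [h1]
  exact ((((measurable_hess_diag hΞ ha hm hd (v + w)).sub
    (measurable_hess_diag hΞ ha hm hd v)).sub (measurable_hess_diag hΞ ha hm hd w))).div_const 2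

end Measurability
end MomentPrior

namespace MomentPrior
open Topology Set

/-! ### Measurable envelope of the second-order remainder -/

section Envelope

variable {Y : Type*} {d : ℕ} {Ξ : Set (EuclideanSpace ℝ (Fin d))}
  {f : EuclideanSpace ℝ (Fin d) → Y → ℝ} {a : EuclideanSpace ℝ (Fin d)} {r : ℝ}

/-- The supremum of the normalized second-order remainder `|quadRem| / ‖x‖ ^ 2` of the unit
log-likelihood over `‖x‖ < r`. It is taken over a countable dense set of displacements, which makes
it measurable in the observation; by continuity it bounds the remainder at all displacements. -/
noncomputable def remSup (f : EuclideanSpace ℝ (Fin d) → Y → ℝ) (a : EuclideanSpace ℝ (Fin d)) (r : ℝ)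
    (y : Y) : ℝ≥0∞ :=
  ⨆ i : ℕ, ⨆ _ : ‖TopologicalSpace.denseSeq (EuclideanSpace ℝ (Fin d)) i‖ < r,
    ENNReal.ofReal (|quadRem (logLik f y) a (TopologicalSpace.denseSeq _ i)| /
      ‖TopologicalSpace.denseSeq (EuclideanSpace ℝ (Fin d)) i‖ ^ 2)

theorem measurable_remSup [MeasurableSpace Y] (hΞ : IsOpen Ξ) (ha : a ∈ Ξ)
    (hr : Metric.ball a r ⊆ Ξ) (hm : ∀ ξ ∈ Ξ, Measurable fun y => logLik f y ξ)
    (hd : ∀ y, ContDiffOn ℝ 2 (logLik f y) Ξ) : Measurable (remSup f a r) := by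
  refine Measurable.iSup fun i => Measurable.iSup fun hi => ?_
  set x := TopologicalSpace.denseSeq (EuclideanSpace ℝ (Fin d)) i
  have hx : a + x ∈ Ξ := hr (by simpa using hi)
  have hdiff : ∀ y, DifferentiableAt ℝ (logLik f y) a := fun y =>
    ((hd y).contDiffAt (hΞ.mem_nhds ha)).differentiableAt (by norm_num)
  have h1 : Measurable fun y => quadRem (logLik f y) a x :=
    (((hm _ hx).sub (hm a ha)).sub (measurable_fderiv_logLik hΞ ha hm hdiff x)).sub
      ((measurable_hess_diag hΞ ha hm hd x).div_const 2)
  exact (h1.abs.div_const _).ennreal_ofReal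

/-- By continuity in the displacement, the supremum over a dense set bounds the remainder
everywhere. At `x = 0` the quotient is `0 / 0 = 0`. -/
theorem ofReal_quadRem_le_remSup (hr : Metric.ball a r ⊆ Ξ) (hΞ : IsOpen Ξ) {y : Y}
    (hd : ContDiffOn ℝ 2 (logLik f y) Ξ) {x : EuclideanSpace ℝ (Fin d)} (hx : ‖x‖ < r) :
    ENNReal.ofReal (|quadRem (logLik f y) a x| / ‖x‖ ^ 2) ≤ remSup f a r y := by
  by_contra! hlt
  have hx0 : ‖x‖ ≠ 0 := fun h => by simp [h] at hlt
  have hℓ : ContinuousAt (fun z => logLik f y (a + z)) x := by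
    have h1 : ContinuousAt (logLik f y) (a + x) :=
      hd.continuousOn.continuousAt (hΞ.mem_nhds (hr (by simpa using hx)))
    exact ContinuousAt.comp (f := fun z => a + z) h1 (by fun_prop)
  have hh : Continuous fun z => hess (logLik f y) a z z :=
    (fderiv ℝ (fderiv ℝ (logLik f y)) a).continuous.clm_apply continuous_id
  have hq : ContinuousAt (fun z => quadRem (logLik f y) a z) x :=
    ((hℓ.sub continuousAt_const).sub (fderiv ℝ (logLik f y) a).continuous.continuousAt).sub
      (hh.continuousAt.div_const 2)
  have hc : ContinuousAt
      (fun z => ENNReal.ofReal (|quadRem (logLik f y) a z| / ‖z‖ ^ 2)) x :=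
    ENNReal.continuous_ofReal.continuousAt.comp
      (hq.abs.div (continuous_norm.pow 2).continuousAt (pow_ne_zero 2 hx0))
  have hev := (hc.eventually (lt_mem_nhds hlt)).and
    (continuous_norm.continuousAt.eventually (gt_mem_nhds hx))
  obtain ⟨U, hU, hUo, hxU⟩ := eventually_nhds_iff.1 hev
  obtain ⟨z, hzU, i, rfl⟩ := (TopologicalSpace.denseRange_denseSeq
    (EuclideanSpace ℝ (Fin d))).inter_open_nonempty U hUo ⟨x, hxU⟩
  obtain ⟨h1, h2⟩ := hU _ hzU
  refine absurd h1 (not_lt.2 ?_)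
  exact le_iSup₂_of_le (f := fun i _ => _) i h2 le_rfl

theorem remSup_le {y : Y} {c : ℝ}
    (h : ∀ x, ‖x‖ < r → |quadRem (logLik f y) a x| ≤ c * ‖x‖ ^ 2) (hc : 0 ≤ c) :
    remSup f a r y ≤ ENNReal.ofReal c := by
  refine iSup₂_le fun i hi => ENNReal.ofReal_le_ofReal ?_
  exact div_le_of_le_mul₀ (by positivity) hc (h _ hi)

theorem tendsto_remSup (hΞ : IsOpen Ξ) (ha : a ∈ Ξ) {y : Y}
    (hd : ContDiffOn ℝ 2 (logLik f y) Ξ) {t : ℕ → ℝ} (ht : Tendsto t atTop (𝓝 0)) :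
    Tendsto (fun n => remSup f a (t n) y) atTop (𝓝 0) := by
  rw [ENNReal.tendsto_nhds_zero]
  intro ε hε
  obtain ⟨δ, hδ, hδε⟩ := ENNReal.lt_iff_exists_real_btwn.1 hε
  have hδ0 : 0 < δ := by simpa using hδε.1
  obtain ⟨r, hr, hrem⟩ := exists_abs_quadRem_le hΞ hd ha hδ0
  filter_upwards [ht.eventually (gt_mem_nhds hr)] with n hn
  exact (remSup_le (fun x hx => hrem x (hx.trans hn)) hδ).trans hδε.2.le

end Envelope

/-! ### Moments of the score, the Hessian and the remainder -/

namespace IsRegularModel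

variable {Y : Type*} [MeasurableSpace Y] {μ : Measure Y} {q : Y → ℝ} {d : ℕ}
  {Ξ : Set (EuclideanSpace ℝ (Fin d))} {f : EuclideanSpace ℝ (Fin d) → Y → ℝ}
  {ξs : EuclideanSpace ℝ (Fin d)}

theorem measurable_logLik (hM : IsRegularModel μ q Ξ f ξs) {ξ : EuclideanSpace ℝ (Fin d)}
    (hξ : ξ ∈ Ξ) : Measurable fun y => logLik f y ξ :=
  (hM.density ξ hξ).measurable.log

theorem differentiableAt_logLik (hM : IsRegularModel μ q Ξ f ξs) (y : Y) :
    DifferentiableAt ℝ (logLik f y) ξs :=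
  ((hM.contDiffOn y).contDiffAt (hM.isOpen.mem_nhds hM.proj_mem)).differentiableAt (by norm_num)

theorem measurable_score (hM : IsRegularModel μ q Ξ f ξs) (v : EuclideanSpace ℝ (Fin d)) :
    Measurable fun y => fderiv ℝ (logLik f y) ξs v :=
  measurable_fderiv_logLik hM.isOpen hM.proj_mem (fun _ hξ => hM.measurable_logLik hξ)
    hM.differentiableAt_logLik v

theorem memLp_score (hM : IsRegularModel μ q Ξ f ξs) (v : EuclideanSpace ℝ (Fin d)) :
    MemLp (fun y => fderiv ℝ (logLik f y) ξs v) 2 (law μ q) := by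
  rw [memLp_two_iff_integrable_sq (hM.measurable_score v).aestronglyMeasurable]
  refine (hM.integrable_score.const_mul (‖v‖ ^ 2)).mono'
    ((hM.measurable_score v).pow_const 2).aestronglyMeasurable (Eventually.of_forall fun y => ?_)
  have h1 : ‖gradient (logLik f y) ξs‖ = ‖fderiv ℝ (logLik f y) ξs‖ := by
    rw [gradient, LinearIsometryEquiv.norm_map]
  have h2 := (fderiv ℝ (logLik f y) ξs).le_opNorm v
  rw [h1, Real.norm_of_nonneg (sq_nonneg _), ← mul_pow, ← sq_abs, ← Real.norm_eq_abs,
    mul_comm ‖v‖]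
  gcongr

theorem memLp_log_ratio (hq : IsPosDensity μ q) (hM : IsRegularModel μ q Ξ f ξs) :
    MemLp (fun y => Real.log (q y / f ξs y)) 2 (law μ q) :=
  memLp_two_log_ratio hq (hM.density ξs hM.proj_mem) hM.var_lt_top

/-- The score at the Kullback--Leibler projection has mean zero, as the gradient of the divergence
at its minimum: the divergence at `ξs + t v` is the one at `ξs`, minus `t` times the mean score
along `v`, up to a term of order `t ^ 2`. -/
theorem integral_score_eq_zero [SigmaFinite μ] (hq : IsPosDensity μ q)
    (hM : IsRegularModel μ q Ξ f ξs) (v : EuclideanSpace ℝ (Fin d)) :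
    ∫ y, fderiv ℝ (logLik f y) ξs v ∂(law μ q) = 0 := by
  have := hq.isProbabilityMeasure_law
  obtain ⟨r, hr, hball, c, hci, hc⟩ := hM.hess_dominated
  set K := ∫ y, (d : ℝ) ^ 2 * c y ∂(law μ q) with hK
  have hSi : ∀ x, Integrable (fun y => fderiv ℝ (logLik f y) ξs x) (law μ q) := fun x =>
    (hM.memLp_score x).integrable (by norm_num)
  have hφi : Integrable (fun y => Real.log (q y / f ξs y)) (law μ q) :=
    (memLp_log_ratio hq hM).integrable (by norm_num)
  -- minimality of the divergence at `ξs`, compared with `ξs + x`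
  have key : ∀ x, ‖x‖ < r → ∫ y, fderiv ℝ (logLik f y) ξs x ∂(law μ q) ≤ ‖x‖ ^ 2 * K := by
    intro x hx
    have hxΞ : ξs + x ∈ Ξ := hball (by simpa using hx)
    set D : Y → ℝ := fun y => logLik f y (ξs + x) - logLik f y ξs - fderiv ℝ (logLik f y) ξs x
      with hD
    have hDb : ∀ y, ‖D y‖ ≤ ‖x‖ ^ 2 * (d ^ 2 * c y) := by
      intro y
      obtain ⟨t, ht, hmem, h⟩ := exists_taylor_two hM.isOpen (hM.contDiffOn y) hball hx
      have h1 : |hess (logLik f y) (ξs + t • x) x x| ≤ d ^ 2 * c y * ‖x‖ ^ 2 := by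
        rw [hess_eq_sum]; exact abs_quadForm_le (hc y _ hmem) x
      have h2 : D y = hess (logLik f y) (ξs + t • x) x x / 2 := by
        simp only [hD, h]; ring
      rw [h2, Real.norm_eq_abs, abs_div, abs_two]
      have := abs_nonneg (hess (logLik f y) (ξs + t • x) x x)
      linarith
    have hDi : Integrable D (law μ q) :=
      ((hci.const_mul _).const_mul _).mono' (((hM.measurable_logLik hxΞ).sub
        (hM.measurable_logLik hM.proj_mem)).sub (hM.measurable_score x)).aestronglyMeasurable
        (Eventually.of_forall hDb)
    have hDint : |∫ y, D y ∂(law μ q)| ≤ ‖x‖ ^ 2 * K := by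
      have h1 := norm_integral_le_of_norm_le ((hci.const_mul ((d : ℝ) ^ 2)).const_mul (‖x‖ ^ 2))
        (Eventually.of_forall hDb)
      rwa [integral_const_mul, Real.norm_eq_abs] at h1
    have hrel : ∀ y, Real.log (q y / f (ξs + x) y) = Real.log (q y / f ξs y) -
        (fderiv ℝ (logLik f y) ξs x + D y) := by
      intro y
      rw [Real.log_div (hq.pos y).ne' ((hM.density _ hxΞ).pos y).ne',
        Real.log_div (hq.pos y).ne' ((hM.density _ hM.proj_mem).pos y).ne']
      simp only [hD, logLik]
      ring
    have hi2 : Integrable (fun y => Real.log (q y / f (ξs + x) y)) (law μ q) :=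
      (hφi.sub ((hSi x).add hDi)).congr (Eventually.of_forall fun y => (hrel y).symm)
    obtain ⟨h1, h2⟩ := kl_ne_top_and_toReal_eq hq (hM.density _ hM.proj_mem) hφi
    obtain ⟨h3, h4⟩ := kl_ne_top_and_toReal_eq hq (hM.density _ hxΞ) hi2
    have hmin : kl μ q (f ξs) ≤ kl μ q (f (ξs + x)) := by
      rw [hM.proj_eq]
      exact iInf₂_le _ hxΞ
    have hmin' := ENNReal.toReal_mono h3 hmin
    have h5 : ∫ y, Real.log (q y / f (ξs + x) y) ∂(law μ q) =
        ∫ y, Real.log (q y / f ξs y) ∂(law μ q) -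
          (∫ y, fderiv ℝ (logLik f y) ξs x ∂(law μ q) + ∫ y, D y ∂(law μ q)) := by
      have hadd : Integrable (fun y => fderiv ℝ (logLik f y) ξs x + D y) (law μ q) :=
        (hSi x).add hDi
      rw [← integral_add (hSi x) hDi, ← integral_sub hφi hadd]
      exact integral_congr_ae (Eventually.of_forall hrel)
    rw [h2, h4, h5] at hmin'
    have := (abs_le.1 hDint).1
    linarith
  set E := ∫ y, fderiv ℝ (logLik f y) ξs v ∂(law μ q) with hE
  have hlin : ∀ t : ℝ, ∫ y, fderiv ℝ (logLik f y) ξs (t • v) ∂(law μ q) = t * E := fun t => by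
    simp only [map_smul, smul_eq_mul, integral_const_mul, hE]
  have hsmall : ∀ᶠ t : ℝ in 𝓝[>] 0, |E| ≤ t * (‖v‖ ^ 2 * K) := by
    have h0 : Tendsto (fun t : ℝ => ‖t • v‖) (𝓝[>] 0) (𝓝 0) := by
      have : Continuous fun t : ℝ => ‖t • v‖ := by fun_prop
      simpa using (this.tendsto 0).mono_left nhdsWithin_le_nhds
    filter_upwards [h0.eventually (gt_mem_nhds hr), self_mem_nhdsWithin] with t ht ht0
    have ht0' : 0 < t := ht0
    have h1 := key (t • v) ht
    have h2 := key ((-t) • v) (by rwa [neg_smul, norm_neg])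
    rw [hlin, norm_smul, mul_pow, Real.norm_eq_abs, sq_abs] at h1 h2
    rw [abs_le]
    constructor <;> nlinarith
  have hlim : Tendsto (fun t : ℝ => t * (‖v‖ ^ 2 * K)) (𝓝[>] 0) (𝓝 0) := by
    have : Continuous fun t : ℝ => t * (‖v‖ ^ 2 * K) := by fun_prop
    simpa using (this.tendsto 0).mono_left nhdsWithin_le_nhds
  exact abs_eq_zero.1 (le_antisymm (ge_of_tendsto hlim hsmall) (abs_nonneg E))

theorem measurable_hessEntry (hM : IsRegularModel μ q Ξ f ξs)
    (v w : EuclideanSpace ℝ (Fin d)) : Measurable fun y => hess (logLik f y) ξs v w :=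
  measurable_hess hM.isOpen hM.proj_mem (fun _ hξ => hM.measurable_logLik hξ) hM.contDiffOn v w

theorem integrable_hessEntry (hM : IsRegularModel μ q Ξ f ξs) (i j : Fin d) :
    Integrable (fun y => hess (logLik f y) ξs (EuclideanSpace.single i 1)
      (EuclideanSpace.single j 1)) (law μ q) := by
  obtain ⟨r, hr, hball, c, hci, hc⟩ := hM.hess_dominated
  exact hci.mono' (hM.measurable_hessEntry _ _).aestronglyMeasurable
    (Eventually.of_forall fun y => hc y ξs (Metric.mem_ball_self hr) i j)

/-- The expected Hessian is uniformly negative definite. -/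
theorem exists_expected_hess_le (hM : IsRegularModel μ q Ξ f ξs) :
    ∃ lam > 0, ∀ x : EuclideanSpace ℝ (Fin d),
      ∑ i, ∑ j, x i * x j * ∫ y, hess (logLik f y) ξs (EuclideanSpace.single i 1)
        (EuclideanSpace.single j 1) ∂(law μ q) ≤ -(lam * ‖x‖ ^ 2) := by
  set h : Fin d → Fin d → ℝ := fun i j => ∫ y, hess (logLik f y) ξs (EuclideanSpace.single i 1)
    (EuclideanSpace.single j 1) ∂(law μ q) with hh
  set Q : EuclideanSpace ℝ (Fin d) → ℝ := fun x => ∑ i, ∑ j, x i * x j * h i j with hQ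
  have hQint : ∀ x, Q x = ∫ y, hess (logLik f y) ξs x x ∂(law μ q) := by
    intro x
    simp only [hQ, hh, hess_eq_sum ξs x x]
    rw [integral_finsetSum _ fun i _ => integrable_finsetSum _ fun j _ =>
      (hM.integrable_hessEntry i j).const_mul _]
    refine Finset.sum_congr rfl fun i _ => ?_
    rw [integral_finsetSum _ fun j _ => (hM.integrable_hessEntry i j).const_mul _]
    exact Finset.sum_congr rfl fun j _ => (integral_const_mul _ _).symm
  have hQc : Continuous Q := by fun_prop
  have hne : Nontrivial (EuclideanSpace ℝ (Fin d)) :=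
    let ⟨x, _, z, _, hxz⟩ := hM.nontrivial
    ⟨x, z, hxz⟩
  obtain ⟨x₀, hx₀, hmax⟩ := (isCompact_sphere (0 : EuclideanSpace ℝ (Fin d)) 1).exists_isMaxOn
    (NormedSpace.sphere_nonempty.2 zero_le_one) hQc.continuousOn
  have hx₀1 : ‖x₀‖ = 1 := by simpa using hx₀
  refine ⟨-Q x₀, ?_, fun x => ?_⟩
  · rw [gt_iff_lt, neg_pos, hQint]
    exact hM.hess_neg x₀ (fun h0 => by simp [h0] at hx₀1)
  · show Q x ≤ _
    rcases eq_or_ne x 0 with rfl | hx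
    · simp [hQ]
    · have hxn : ‖x‖ ≠ 0 := norm_ne_zero_iff.2 hx
      have h1 : Q (‖x‖⁻¹ • x) ≤ Q x₀ := hmax (by simp [norm_smul, hxn])
      have h2 : Q x = ‖x‖ ^ 2 * Q (‖x‖⁻¹ • x) := by
        simp only [hQ, Finset.mul_sum, PiLp.smul_apply, smul_eq_mul]
        refine Finset.sum_congr rfl fun i _ => Finset.sum_congr rfl fun j _ => ?_
        field_simp
      rw [h2]
      nlinarith [sq_nonneg ‖x‖]

/-- The mean of the second-order remainder envelope tends to zero with the radius. -/
theorem exists_lintegral_remSup_le (hM : IsRegularModel μ q Ξ f ξs) {ε : ℝ≥0∞} (hε : 0 < ε)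
    {ρ : ℝ} (hρ : 0 < ρ) :
    ∃ r > 0, r ≤ ρ ∧ Metric.ball ξs r ⊆ Ξ ∧ ∫⁻ y, remSup f ξs r y ∂(law μ q) ≤ ε := by
  obtain ⟨r₀, hr₀, hball, c, hci, hc⟩ := hM.hess_dominated
  set t : ℕ → ℝ := fun n => min ρ r₀ * (1 / ((n : ℝ) + 1)) with ht
  have hmin : 0 < min ρ r₀ := lt_min hρ hr₀
  have ht0 : ∀ n, 0 < t n := fun n => by simp only [ht]; positivity
  have htle : ∀ n, t n ≤ min ρ r₀ := fun n => by
    simp only [ht]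
    refine mul_le_of_le_one_right hmin.le ?_
    rw [div_le_one (by positivity)]
    linarith [(Nat.cast_nonneg n : (0 : ℝ) ≤ n)]
  have htend : Tendsto t atTop (𝓝 0) := by
    simpa [ht] using tendsto_one_div_add_atTop_nhds_zero_nat.const_mul (min ρ r₀)
  have hsub : ∀ n, Metric.ball ξs (t n) ⊆ Ξ := fun n =>
    (Metric.ball_subset_ball ((htle n).trans (min_le_right _ _))).trans hball
  have hbound : ∀ n y, remSup f ξs (t n) y ≤ ENNReal.ofReal |(d : ℝ) ^ 2 * c y| := fun n y =>
    remSup_le (fun x hx => (abs_quadRem_le hM.isOpen (hM.contDiffOn y) hball (hc y)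
      (hx.trans_le ((htle n).trans (min_le_right _ _)))).trans
        (by gcongr; exact le_abs_self _)) (abs_nonneg _)
  have hfin : ∫⁻ y, ENNReal.ofReal |(d : ℝ) ^ 2 * c y| ∂(law μ q) ≠ ⊤ := by
    have h1 := (hci.const_mul ((d : ℝ) ^ 2)).abs
    exact ((lintegral_ofReal_le_lintegral_enorm _).trans_lt h1.hasFiniteIntegral).ne
  have hlim := tendsto_lintegral_of_dominated_convergence
    (μ := law μ q) (F := fun n => remSup f ξs (t n)) (f := fun _ => 0) _
    (fun n => measurable_remSup hM.isOpen hM.proj_mem (hsub n)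
      (fun _ hξ => hM.measurable_logLik hξ) hM.contDiffOn)
    (fun n => Eventually.of_forall (hbound n)) hfin
    (Eventually.of_forall fun y => tendsto_remSup hM.isOpen hM.proj_mem (hM.contDiffOn y) htend)
  rw [lintegral_zero] at hlim
  obtain ⟨n, hn⟩ := ((ENNReal.tendsto_nhds_zero.1 hlim) ε hε).exists
  exact ⟨t n, ht0 n, (htle n).trans (min_le_left _ _), hsub n, hn⟩

end IsRegularModel
end MomentPrior

/-! ### Quadratic bounds for the log-likelihood and the prior integral -/

namespace MomentPrior
open Topology Set

section UnionBound

variable {Ω : Type*} [MeasurableSpace Ω] {P : Measure Ω}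

theorem measure_iUnion_le_ofReal {ι : Type*} [Fintype ι] {B : ι → Set Ω} {ε : ℝ} (hε : 0 < ε)
    (h : ∀ j, P (B j) ≤ ENNReal.ofReal (ε / (Fintype.card ι + 1))) :
    P (⋃ j, B j) ≤ ENNReal.ofReal ε := by
  have h0 : (0 : ℝ) < Fintype.card ι + 1 := by positivity
  calc P (⋃ j, B j) ≤ ∑ j, P (B j) := measure_iUnion_fintype_le P B
    _ ≤ ∑ _j : ι, ENNReal.ofReal (ε / (Fintype.card ι + 1)) := Finset.sum_le_sum fun j _ => h j
    _ = ENNReal.ofReal (Fintype.card ι * (ε / (Fintype.card ι + 1))) := by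
        rw [Finset.sum_const, Finset.card_univ, nsmul_eq_mul, ENNReal.ofReal_mul (by positivity),
          ENNReal.ofReal_natCast]
    _ ≤ ENNReal.ofReal ε := by
        refine ENNReal.ofReal_le_ofReal ?_
        rw [← mul_div_assoc, div_le_iff₀ h0]
        nlinarith

theorem measure_union_le_ofReal {A B : Set Ω} {ε : ℝ} (hε : 0 < ε)
    (hA : P A ≤ ENNReal.ofReal (ε / 2)) (hB : P B ≤ ENNReal.ofReal (ε / 2)) :
    P (A ∪ B) ≤ ENNReal.ofReal ε := by
  calc P (A ∪ B) ≤ P A + P B := measure_union_le A B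
    _ ≤ ENNReal.ofReal (ε / 2) + ENNReal.ofReal (ε / 2) := add_le_add hA hB
    _ = ENNReal.ofReal ε := by
        rw [← ENNReal.ofReal_add (by positivity) (by positivity), add_halves]

end UnionBound

namespace IsRegularModel

variable {Ω Y : Type*} [MeasurableSpace Ω] [MeasurableSpace Y] {P : Measure Ω}
  {μ : Measure Y} {q : Y → ℝ} {y : ℕ → Ω → Y} {d : ℕ}
  {Ξ : Set (EuclideanSpace ℝ (Fin d))} {f : EuclideanSpace ℝ (Fin d) → Y → ℝ}
  {ξs : EuclideanSpace ℝ (Fin d)}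

/-- With large probability the total score at the projection is of order `√n`, uniformly over
directions. -/
theorem exists_score_bound [IsProbabilityMeasure P] [SigmaFinite μ]
    (hq : IsPosDensity μ q) (hy : IsIIDSample P y μ q) (hM : IsRegularModel μ q Ξ f ξs) {ε : ℝ} (hε : 0 < ε) :
    ∃ A ≥ 0, ∀ᶠ n : ℕ in atTop, P {ω | ¬ ∀ x, |∑ i : Fin n, fderiv ℝ (logLik f (y i ω)) ξs x| ≤
      A * Real.sqrt n * ‖x‖} ≤ ENNReal.ofReal ε := by
  have hε' : 0 < ε / (Fintype.card (Fin d) + 1) := by positivity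
  have h1 : ∀ j : Fin d, ∃ C : ℝ, ∀ᶠ n : ℕ in atTop, P {ω | C * Real.sqrt n <
      |∑ i : Fin n, fderiv ℝ (logLik f (y i ω)) ξs (EuclideanSpace.single j 1)|} ≤
        ENNReal.ofReal (ε / (Fintype.card (Fin d) + 1)) := fun j => by
    obtain ⟨C, hC⟩ := hy.isBigOp_sum (hM.measurable_score (EuclideanSpace.single j 1))
      (hM.memLp_score (EuclideanSpace.single j 1)) _ hε'
    refine ⟨C, ?_⟩
    simpa only [hM.integral_score_eq_zero hq, mul_zero, sub_zero, ← Real.sqrt_eq_rpow] using hC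
  choose C hC using h1
  refine ⟨∑ j, |C j|, Finset.sum_nonneg fun j _ => abs_nonneg _, ?_⟩
  filter_upwards [eventually_all.2 hC] with n hn
  refine (measure_mono fun ω hω => ?_).trans (measure_iUnion_le_ofReal hε hn)
  by_contra hnot
  refine hω fun x => ?_
  simp only [mem_iUnion, mem_ofPred_eq, not_exists, not_lt] at hnot
  have h2 : ∑ i : Fin n, fderiv ℝ (logLik f (y i ω)) ξs x = ∑ j, x j *
      ∑ i : Fin n, fderiv ℝ (logLik f (y i ω)) ξs (EuclideanSpace.single j 1) := by
    simp only [Finset.mul_sum]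
    rw [Finset.sum_comm]
    refine Finset.sum_congr rfl fun i _ => ?_
    conv_lhs => rw [← sum_apply_smul_single x]
    simp
  rw [h2, Finset.sum_mul, Finset.sum_mul]
  refine (Finset.abs_sum_le_sum_abs _ _).trans (Finset.sum_le_sum fun j _ => ?_)
  rw [abs_mul, mul_comm]
  have hx : |x j| ≤ ‖x‖ := PiLp.norm_apply_le x j
  have h3 := (hnot j).trans (mul_le_mul_of_nonneg_right (le_abs_self (C j)) (Real.sqrt_nonneg n))
  gcongr

/-- With large probability the total Hessian at the projection is close to its mean, uniformly over
directions. -/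
theorem eventually_hess_bound [IsProbabilityMeasure P] (hy : IsIIDSample P y μ q)
    (hM : IsRegularModel μ q Ξ f ξs) {η ε : ℝ} (hη : 0 < η) (hε : 0 < ε) :
    ∀ᶠ n : ℕ in atTop, P {ω | ¬ ∀ x : EuclideanSpace ℝ (Fin d),
      |∑ i : Fin n, hess (logLik f (y i ω)) ξs x x - n * ∑ j, ∑ k, x j * x k *
        ∫ z, hess (logLik f z) ξs (EuclideanSpace.single j 1) (EuclideanSpace.single k 1)
          ∂(law μ q)| ≤ d ^ 2 * (η * n) * ‖x‖ ^ 2} ≤ ENNReal.ofReal ε := by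
  set ι := Fin d × Fin d
  have hε' : 0 < ENNReal.ofReal (ε / (Fintype.card ι + 1)) := by
    rw [ENNReal.ofReal_pos]; positivity
  have h1 := fun p : ι => (ENNReal.tendsto_nhds_zero.1 (hy.tendsto_measure_average
    (hM.measurable_hessEntry (EuclideanSpace.single p.1 1) (EuclideanSpace.single p.2 1))
    (hM.integrable_hessEntry p.1 p.2) hη)) _ hε'
  filter_upwards [eventually_all.2 h1] with n hn
  refine (measure_mono fun ω hω => ?_).trans (measure_iUnion_le_ofReal hε hn)
  by_contra hnot
  refine hω fun x => ?_
  simp only [mem_iUnion, mem_ofPred_eq, not_exists, not_lt] at hnot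
  have h2 := abs_quadForm_le (fun j k => hnot (j, k)) x
  refine le_trans (le_of_eq (congrArg abs ?_)) h2
  simp only [hess_eq_sum ξs x x, mul_sub, Finset.sum_sub_distrib]
  congr 1
  · rw [Finset.sum_comm]
    refine Finset.sum_congr rfl fun j _ => ?_
    rw [Finset.sum_comm]
    exact Finset.sum_congr rfl fun k _ => (Finset.mul_sum _ _ _).symm
  · rw [Finset.mul_sum]
    refine Finset.sum_congr rfl fun j _ => ?_
    rw [Finset.mul_sum]
    exact Finset.sum_congr rfl fun k _ => by ring

/-- With large probability the accumulated second-order remainder is at most `η n ‖x‖ ^ 2` in a small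
ball, whose radius does not depend on `n`. -/
theorem exists_quadRem_bound (hy : IsIIDSample P y μ q)
    (hM : IsRegularModel μ q Ξ f ξs) {η ε ρ : ℝ} (hη : 0 < η) (hε : 0 < ε) (hρ : 0 < ρ) :
    ∃ r > 0, r ≤ ρ ∧ ∀ᶠ n : ℕ in atTop, P {ω | ¬ ∀ x : EuclideanSpace ℝ (Fin d), ‖x‖ < r →
      |∑ i : Fin n, quadRem (logLik f (y i ω)) ξs x| ≤ η * n * ‖x‖ ^ 2} ≤ ENNReal.ofReal ε := by
  obtain ⟨r, hr, hrρ, hball, hW⟩ := hM.exists_lintegral_remSup_le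
    (ε := ENNReal.ofReal (ε * η)) (by rw [ENNReal.ofReal_pos]; positivity) hρ
  refine ⟨r, hr, hrρ, ?_⟩
  have hWm : Measurable (remSup f ξs r) := measurable_remSup hM.isOpen hM.proj_mem hball
    (fun _ hξ => hM.measurable_logLik hξ) hM.contDiffOn
  filter_upwards [eventually_ge_atTop 1] with n hn
  have h1 := hy.measure_lt_sum_le hWm hη hn
  have h2 : (∫⁻ z, remSup f ξs r z ∂(law μ q)) / ENNReal.ofReal η ≤ ENNReal.ofReal ε := by
    refine ENNReal.div_le_of_le_mul ?_
    rwa [← ENNReal.ofReal_mul hε.le]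
  refine (measure_mono fun ω hω => ?_).trans (h1.trans h2)
  by_contra hnot
  refine hω fun x hx => ?_
  rw [mem_ofPred_eq, not_lt] at hnot
  have h3 : ENNReal.ofReal (∑ i : Fin n, |quadRem (logLik f (y i ω)) ξs x| / ‖x‖ ^ 2) ≤
      ENNReal.ofReal (η * n) := by
    rw [ENNReal.ofReal_sum_of_nonneg fun i _ => by positivity]
    exact (Finset.sum_le_sum fun i _ =>
      ofReal_quadRem_le_remSup hball hM.isOpen (hM.contDiffOn _) hx).trans hnot
  rw [ENNReal.ofReal_le_ofReal_iff (by positivity), ← Finset.sum_div] at h3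
  rcases eq_or_ne x 0 with rfl | hx0
  · simp [quadRem, hess]
  · have hxn : 0 < ‖x‖ := norm_pos_iff.2 hx0
    rw [div_le_iff₀ (by positivity)] at h3
    exact (Finset.abs_sum_le_sum_abs _ _).trans h3

/-- With large probability the log-likelihood ratio lies, in a small ball around the projection,
between two quadratic functions of `√n x`, the upper one having a negative leading coefficient. -/
theorem exists_quadratic_bounds [IsProbabilityMeasure P] [SigmaFinite μ]
    (hq : IsPosDensity μ q) (hy : IsIIDSample P y μ q) (hM : IsRegularModel μ q Ξ f ξs)
    {ε ρ : ℝ} (hε : 0 < ε) (hρ : 0 < ρ) :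
    ∃ r > 0, r < ρ ∧ ∃ A ≥ 0, ∃ lam > 0, ∃ Lam ≥ 0, ∀ᶠ n : ℕ in atTop,
      P {ω | ¬ ∀ x : EuclideanSpace ℝ (Fin d), ‖x‖ ≤ r →
        (∑ i : Fin n, (logLik f (y i ω) (ξs + x) - logLik f (y i ω) ξs) ≤
          A * Real.sqrt n * ‖x‖ - lam * Real.sqrt n ^ 2 * ‖x‖ ^ 2) ∧
        -(A * Real.sqrt n * ‖x‖) - Lam * Real.sqrt n ^ 2 * ‖x‖ ^ 2 ≤
          ∑ i : Fin n, (logLik f (y i ω) (ξs + x) - logLik f (y i ω) ξs)} ≤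
        ENNReal.ofReal ε := by
  obtain ⟨lam, hlam, hneg⟩ := hM.exists_expected_hess_le
  set h : Fin d → Fin d → ℝ := fun i j => ∫ z, hess (logLik f z) ξs (EuclideanSpace.single i 1)
    (EuclideanSpace.single j 1) ∂(law μ q) with hh
  set c := ∑ i, ∑ j, |h i j| with hc
  have hc0 : 0 ≤ c := Finset.sum_nonneg fun i _ => Finset.sum_nonneg fun j _ => abs_nonneg _
  have hhc : ∀ i j, |h i j| ≤ c := fun i j =>
    (Finset.single_le_sum (f := fun j => |h i j|) (fun _ _ => abs_nonneg _)
      (Finset.mem_univ j)).trans (Finset.single_le_sum (f := fun i => ∑ j, |h i j|)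
        (fun _ _ => Finset.sum_nonneg fun _ _ => abs_nonneg _) (Finset.mem_univ i))
  obtain ⟨A, hA, hS⟩ := hM.exists_score_bound hq hy (half_pos hε)
  set η := lam / (4 * (d ^ 2 + 1)) with hη
  have hη0 : 0 < η := by positivity
  have hdη : d ^ 2 * η ≤ lam / 4 := by
    rw [hη, ← mul_div_assoc, div_le_div_iff₀ (by positivity) (by norm_num)]
    nlinarith
  have hH := hM.eventually_hess_bound hy hη0 (half_pos (half_pos hε))
  obtain ⟨r, hr, hrρ, hR⟩ := hM.exists_quadRem_bound hy (η := lam / 8) (by positivity)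
    (half_pos (half_pos hε)) hρ
  refine ⟨r / 2, half_pos hr, (half_lt_self hr).trans_le hrρ, A, hA, lam / 4, by positivity,
    d ^ 2 * c / 2 + lam / 4, by positivity, ?_⟩
  filter_upwards [hS, hH, hR] with n hSn hHn hRn
  refine (measure_mono fun ω hω => ?_).trans (measure_union_le_ofReal hε hSn
    (measure_union_le_ofReal (half_pos hε) hHn hRn))
  by_contra hnot
  simp only [mem_union, mem_ofPred_eq, not_or, not_not] at hnot
  obtain ⟨h1, h2, h3⟩ := hnot
  refine hω fun x hx => ?_
  have h1x := abs_le.1 (h1 x)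
  have h2x := abs_le.1 (h2 x)
  have h3x := abs_le.1 (h3 x (hx.trans_lt (half_lt_self hr)))
  have h4 : ∑ i : Fin n, (logLik f (y i ω) (ξs + x) - logLik f (y i ω) ξs) =
      ∑ i : Fin n, fderiv ℝ (logLik f (y i ω)) ξs x +
        (∑ i : Fin n, hess (logLik f (y i ω)) ξs x x) / 2 +
        ∑ i : Fin n, quadRem (logLik f (y i ω)) ξs x := by
    rw [Finset.sum_div, ← Finset.sum_add_distrib, ← Finset.sum_add_distrib]
    exact Finset.sum_congr rfl fun i _ => by rw [quadRem]; ring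
  have hn0 : (0 : ℝ) ≤ n := Nat.cast_nonneg n
  have h5 := mul_le_mul_of_nonneg_left (hneg x) hn0
  have h6 := mul_le_mul_of_nonneg_left (abs_le.1 (abs_quadForm_le hhc x)).1 hn0
  have h7 : d ^ 2 * (η * n) * ‖x‖ ^ 2 ≤ lam / 4 * n * ‖x‖ ^ 2 := by
    rw [← mul_assoc]; gcongr
  rw [h4, Real.sq_sqrt hn0]
  constructor <;> nlinarith

/-- The integral of the likelihood ratio `fⁿ(y | ξ) / fⁿ(y | ξs)` with respect to the moment prior is
of exact order `n ^ (-(d / 2 + h))` in probability, where `h` is the order of the prior at `ξs`. -/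
theorem exists_log_integral_bound [IsProbabilityMeasure P] [SigmaFinite μ]
    (hq : IsPosDensity μ q) (hy : IsIIDSample P y μ q) (hM : IsRegularModel μ q Ξ f ξs)
    {g p : EuclideanSpace ℝ (Fin d) → ℝ} (hgp : IsRegularMomentPrior Ξ g p)
    {ε : ℝ} (hε : 0 < ε) :
    ∃ C : ℝ, ∀ᶠ n : ℕ in atTop, P {ω | ¬
      (0 < ∫ ξ in Ξ, Real.exp (∑ i : Fin n, (logLik f (y i ω) ξ - logLik f (y i ω) ξs)) *
          momentPrior Ξ g p ξ ∧
        |Real.log (∫ ξ in Ξ, Real.exp (∑ i : Fin n, (logLik f (y i ω) ξ - logLik f (y i ω) ξs)) *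
          momentPrior Ξ g p ξ) + ((d : ℝ) / 2 + momentOrder g ξs) * Real.log n| ≤ C)} ≤
      ENNReal.ofReal ε := by
  obtain ⟨⟨ρ, hρ, M, hup⟩, u₀, ρ', hρ', c, hc, τ, hτ, hlow⟩ :=
    momentPrior_local_bounds hM.isOpen hgp hM.proj_mem
  obtain ⟨r, hr, hrρ, A, hA, lam, hlam, Lam, hLam, hev⟩ := hM.exists_quadratic_bounds hq hy hε hρ
  have hπi : IntegrableOn (momentPrior Ξ g p) Ξ := hgp.integrableOn.div_const _
  have hπ0 : ∀ ξ ∈ Ξ, 0 ≤ momentPrior Ξ g p ξ := fun ξ hξ =>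
    div_nonneg (mul_nonneg (hgp.moment_nonneg ξ hξ) (hgp.prior_pos ξ hξ).le) hgp.normConst_pos.le
  obtain ⟨C, S, hCS⟩ := exists_laplace_bound hM.isOpen hπi hπ0 hr
    (fun x hx => hup x (hx.trans_lt hrρ)) hρ' hc hτ hlow hA hlam hLam
  refine ⟨C, ?_⟩
  filter_upwards [hev, eventually_ge_atTop 1,
    (Real.tendsto_sqrt_atTop.comp tendsto_natCast_atTop_atTop).eventually (eventually_ge_atTop S)]
    with n hn hn1 hnS
  refine (measure_mono fun ω hω => ?_).trans hn
  by_contra hnot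
  rw [mem_ofPred_eq, not_not] at hnot
  refine hω ?_
  have hn0 : (0 : ℝ) < n := by exact_mod_cast hn1
  have hcont : ContinuousOn (fun ξ => ∑ i : Fin n, (logLik f (y i ω) ξ - logLik f (y i ω) ξs)) Ξ :=
    continuousOn_finsetSum _ fun i _ => (hM.contDiffOn _).continuousOn.sub continuousOn_const
  have hconn : ∀ T : ℝ, IsPreconnected
      {ξ ∈ Ξ | T < ∑ i : Fin n, (logLik f (y i ω) ξ - logLik f (y i ω) ξs)} := fun T => by
    convert! hM.levelSets n hn1 (sample y n ω)
      ((n : ℝ)⁻¹ * (T + ∑ i : Fin n, logLik f (y i ω) ξs)) using 4 with ξ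
    rw [mul_lt_mul_iff_right₀ (inv_pos.2 hn0), Finset.sum_sub_distrib, lt_sub_iff_add_lt]
    rfl
  have hres := hCS (Real.sqrt n) hnS _ hcont (by simp) (fun x hx => (hnot x hx).1)
    (fun x hx => (hnot x hx).2) hconn
  refine ⟨hres.1, ?_⟩
  have hlog : ((d : ℝ) + (2 * momentOrder g ξs : ℕ)) * Real.log (Real.sqrt n) =
      ((d : ℝ) / 2 + momentOrder g ξs) * Real.log n := by
    rw [Real.log_sqrt hn0.le]
    push_cast
    ring
  rw [← hlog]
  exact hres.2

/-- The likelihood at the projection factors out of the marginal likelihood. -/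
theorem marginalLik_eq (hM : IsRegularModel μ q Ξ f ξs)
    (g p : EuclideanSpace ℝ (Fin d) → ℝ) {n : ℕ} (z : Fin n → Y) :
    marginalLik Ξ f g p z = jointDensity (f ξs) z *
      ∫ ξ in Ξ, Real.exp (∑ i, (logLik f (z i) ξ - logLik f (z i) ξs)) *
        momentPrior Ξ g p ξ := by
  rw [marginalLik, ← integral_const_mul]
  refine setIntegral_congr_fun hM.isOpen.measurableSet fun ξ hξ => ?_
  have h1 : jointDensity (f ξ) z =
      jointDensity (f ξs) z * Real.exp (∑ i, (logLik f (z i) ξ - logLik f (z i) ξs)) := by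
    rw [Real.exp_sum, jointDensity, jointDensity, ← Finset.prod_mul_distrib]
    refine Finset.prod_congr rfl fun i _ => ?_
    rw [logLik, logLik, Real.exp_sub, Real.exp_log ((hM.density ξ hξ).pos _),
      Real.exp_log ((hM.density ξs hM.proj_mem).pos _)]
    field_simp [((hM.density ξs hM.proj_mem).pos (z i)).ne']
  simp only [h1, mul_assoc]

end IsRegularModel

section LogRatio

theorem log_jointDensity_div {Y : Type*} {q f : Y → ℝ} (hq : ∀ y, 0 < q y)
    (hf : ∀ y, 0 < f y) {n : ℕ} (z : Fin n → Y) :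
    Real.log (jointDensity f z / jointDensity q z) = -∑ i, Real.log (q (z i) / f (z i)) := by
  rw [jointDensity, jointDensity, ← Finset.prod_div_distrib,
    Real.log_prod fun i _ => (div_pos (hf _) (hq _)).ne', ← Finset.sum_neg_distrib]
  refine Finset.sum_congr rfl fun i _ => ?_
  rw [← Real.log_inv, inv_div]

variable {Ω Y : Type*} [MeasurableSpace Ω] [MeasurableSpace Y] {P : Measure Ω}
  {μ : Measure Y} {q f : Y → ℝ} {y : ℕ → Ω → Y}

/-- Almost surely, the likelihoods of two densities that are equal almost everywhere agree at all
sample sizes. -/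
theorem IsIIDSample.ae_log_jointDensity_div_eq_zero (hy : IsIIDSample P y μ q)
    (hq : ∀ y, 0 < q y) (h : f =ᵐ[μ] q) :
    ∀ᵐ ω ∂P, ∀ n, Real.log (jointDensity f (sample y n ω) / jointDensity q (sample y n ω)) = 0 := by
  have h1 : ∀ i, ∀ᵐ ω ∂P, f (y i ω) = q (y i ω) := fun i => by
    have h2 : ∀ᵐ z ∂(P.map (y i)), f z = q z := by
      rw [hy.map_eq]
      exact law_absolutelyContinuous.ae_le h
    exact ae_of_ae_map (hy.measurable i).aemeasurable h2
  filter_upwards [ae_all_iff.2 h1] with ω hω n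
  have h3 : jointDensity f (sample y n ω) = jointDensity q (sample y n ω) :=
    Finset.prod_congr rfl fun i _ => hω i
  rw [h3, div_self (jointDensity_pos hq _).ne', Real.log_one]

theorem IsIIDSample.isBigOp_log_jointDensity [IsProbabilityMeasure P] [SigmaFinite μ]
    (hy : IsIIDSample P y μ q) (hq : IsPosDensity μ q) (hf : IsPosDensity μ f)
    (hφ : MemLp (fun y => Real.log (q y / f y)) 2 (law μ q)) :
    IsBigOp P (fun n ω =>
      Real.log (jointDensity f (sample y n ω) / jointDensity q (sample y n ω)) -
        (-((n : ℝ) * (kl μ q f).toReal))) (fun n => (n : ℝ) ^ (1 / 2 : ℝ)) := by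
  have := hq.isProbabilityMeasure_law
  have hK := (kl_ne_top_and_toReal_eq hq hf (hφ.integrable (by norm_num))).2
  have h1 := hy.isBigOp_sum (hq.measurable.div hf.measurable).log hφ
  intro ε hε
  obtain ⟨C, hC⟩ := h1 ε hε
  refine ⟨C, hC.mono fun n hn => le_trans (measure_mono fun ω hω => ?_) hn⟩
  rw [mem_ofPred_eq] at hω ⊢
  simp only [log_jointDensity_div hq.pos hf.pos, hK, ← neg_sub', abs_neg] at hω
  exact hω

end LogRatio

/-- In a regular model that contains the sampling density, the projection is the sampling
density. -/
theorem IsRegularModel.proj_ae_eq {Y : Type*} [MeasurableSpace Y] {μ : Measure Y} [SigmaFinite μ]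
    {q : Y → ℝ} {d : ℕ} {Ξ : Set (EuclideanSpace ℝ (Fin d))}
    {f : EuclideanSpace ℝ (Fin d) → Y → ℝ} {ξs : EuclideanSpace ℝ (Fin d)}
    (hq : IsPosDensity μ q) (hM : IsRegularModel μ q Ξ f ξs) (hmem : MemModel μ q Ξ f) :
    f ξs =ᵐ[μ] q := by
  obtain ⟨ξ, hξ, h⟩ := hmem
  have h0 := kl_eq_zero_of_ae_eq hq h
  have h1 : klModel μ q Ξ f = 0 := le_antisymm ((iInf₂_le ξ hξ).trans_eq h0) zero_le
  rw [← hM.proj_unique ξ hξ (h0.trans h1.symm)]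
  exact h

/-- On the event where the prior integral is positive, the log marginal likelihood splits into the
log-likelihood at the projection and the logarithm of the prior integral. -/
theorem IsRegularModel.log_marginalLik_div {Y : Type*} [MeasurableSpace Y] {μ : Measure Y}
    {q : Y → ℝ} {d : ℕ} {Ξ : Set (EuclideanSpace ℝ (Fin d))}
    {f : EuclideanSpace ℝ (Fin d) → Y → ℝ} {ξs : EuclideanSpace ℝ (Fin d)}
    (hq : IsPosDensity μ q) (hM : IsRegularModel μ q Ξ f ξs)
    (g p : EuclideanSpace ℝ (Fin d) → ℝ) {n : ℕ} (z : Fin n → Y)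
    (hpos : 0 < ∫ ξ in Ξ, Real.exp (∑ i, (logLik f (z i) ξ - logLik f (z i) ξs)) *
        momentPrior Ξ g p ξ) :
    Real.log (marginalLik Ξ f g p z / jointDensity q z) =
      Real.log (jointDensity (f ξs) z / jointDensity q z) +
      Real.log (∫ ξ in Ξ, Real.exp (∑ i, (logLik f (z i) ξ - logLik f (z i) ξs)) *
        momentPrior Ξ g p ξ) := by
  rw [hM.marginalLik_eq, mul_div_right_comm, Real.log_mul _ hpos.ne']
  exact (div_pos (jointDensity_pos (hM.density ξs hM.proj_mem).pos z)
    (jointDensity_pos hq.pos z)).ne'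

end MomentPrior

/-! ### The log marginal likelihood -/

namespace MomentPrior
open Topology Set

section Marginal

variable {Ω Y : Type*} [MeasurableSpace Ω] [MeasurableSpace Y] {P : Measure Ω}
  [IsProbabilityMeasure P] {μ : Measure Y} [SigmaFinite μ] {q : Y → ℝ} {y : ℕ → Ω → Y} {d : ℕ}
  {Ξ : Set (EuclideanSpace ℝ (Fin d))} {f : EuclideanSpace ℝ (Fin d) → Y → ℝ}
  {ξs : EuclideanSpace ℝ (Fin d)} {g p : EuclideanSpace ℝ (Fin d) → ℝ}

/-- The log marginal likelihood of a regular model decreases linearly in the sample size, at the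
rate given by the divergence: the contribution of the prior integral is logarithmic, hence negligible
at scale `√n`. -/
theorem IsRegularModel.isBigOp_log_marginalLik_sqrt (hq : IsPosDensity μ q)
    (hy : IsIIDSample P y μ q) (hM : IsRegularModel μ q Ξ f ξs)
    (hgp : IsRegularMomentPrior Ξ g p) :
    IsBigOp P (fun n ω => Real.log (marginalLik Ξ f g p (sample y n ω) /
      jointDensity q (sample y n ω)) - (-((n : ℝ) * (klModel μ q Ξ f).toReal)))
      (fun n => (n : ℝ) ^ (1 / 2 : ℝ)) := by
  intro ε hε
  obtain ⟨C₁, hC₁⟩ := hy.isBigOp_log_jointDensity hq (hM.density ξs hM.proj_mem)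
    (hM.memLp_log_ratio hq) _ (half_pos hε)
  obtain ⟨C₂, hC₂⟩ := hM.exists_log_integral_bound hq hy hgp (half_pos hε)
  set k : ℝ := (d : ℝ) / 2 + momentOrder g ξs with hk
  have hk0 : 0 ≤ k := by positivity
  have hlog := (isLittleO_log_rpow_atTop (r := 1 / 2) (by norm_num)).bound (c := 1) one_pos
  refine ⟨C₁ + |C₂| + k, ?_⟩
  filter_upwards [hC₁, hC₂, eventually_ge_atTop 1, tendsto_natCast_atTop_atTop.eventually hlog]
    with n h1 h2 hn hl
  refine (measure_mono fun ω hω => ?_).trans (measure_union_le_ofReal hε h1 h2)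
  by_contra hnot
  simp only [mem_union, mem_ofPred_eq, not_or, not_not, not_lt] at hnot
  obtain ⟨h3, hpos, h4⟩ := hnot
  rw [mem_ofPred_eq] at hω
  refine absurd hω (not_lt.2 ?_)
  have hs1 : 1 ≤ (n : ℝ) ^ (1 / 2 : ℝ) := Real.one_le_rpow (by exact_mod_cast hn) (by norm_num)
  rw [one_mul, Real.norm_eq_abs, Real.norm_of_nonneg (by positivity)] at hl
  have h5 := hM.log_marginalLik_div hq g p (sample y n ω) hpos
  have h6 : k * |Real.log n| ≤ k * (n : ℝ) ^ (1 / 2 : ℝ) := by gcongr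
  have h7 : |C₂| ≤ |C₂| * (n : ℝ) ^ (1 / 2 : ℝ) := le_mul_of_one_le_right (abs_nonneg _) hs1
  have h8 : |k * Real.log n| = k * |Real.log n| := by rw [abs_mul, abs_of_nonneg hk0]
  have h9 := abs_le.1 h8.le
  have h10 := le_abs_self C₂
  rw [← hM.proj_eq, h5]
  simp only [sample] at h3 ⊢
  rw [abs_le] at h3 h4 ⊢
  constructor <;> linarith [h3.1, h3.2, h4.1, h4.2, h9.1, h9.2]

/-- If the model contains the sampling density, the likelihood at the projection cancels and only
the prior integral remains. -/
theorem IsRegularModel.isBigOp_log_marginalLik_one (hq : IsPosDensity μ q)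
    (hy : IsIIDSample P y μ q) (hM : IsRegularModel μ q Ξ f ξs)
    (hgp : IsRegularMomentPrior Ξ g p) (hmem : MemModel μ q Ξ f) :
    IsBigOp P (fun n ω => Real.log (marginalLik Ξ f g p (sample y n ω) /
      jointDensity q (sample y n ω)) -
        (-((d : ℝ) / 2 * Real.log n) - (momentOrder g ξs : ℝ) * Real.log n)) (fun _ => 1) := by
  intro ε hε
  obtain ⟨C, hC⟩ := hM.exists_log_integral_bound hq hy hgp hε
  refine ⟨C, hC.mono fun n hn => ?_⟩
  refine (measure_mono_ae ?_).trans hn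
  filter_upwards [hy.ae_log_jointDensity_div_eq_zero hq.pos (hM.proj_ae_eq hq hmem)] with ω h0 hω
  rintro ⟨hpos, h1⟩
  have h2 := hM.log_marginalLik_div hq g p (sample y n ω) hpos
  rw [h0 n, zero_add] at h2
  refine absurd (show _ < _ from hω) (not_lt.2 ?_)
  rw [mul_one, h2]
  refine le_trans (le_of_eq (congrArg abs ?_)) h1
  simp only [sample]
  ring

end Marginal
end MomentPrior

theorem theorem2 {Ω Y : Type*} [MeasurableSpace Ω] [MeasurableSpace Y]
    (P : Measure Ω) [IsProbabilityMeasure P] (μ : Measure Y) [SigmaFinite μ]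
    (q : Y → ℝ) (hq : MomentPrior.IsPosDensity μ q)
    (y : ℕ → Ω → Y) (hy : MomentPrior.IsIIDSample P y μ q) :
    -- nonsingleton models
    (∀ (d : ℕ) (Ξ : Set (EuclideanSpace ℝ (Fin d))) (f : EuclideanSpace ℝ (Fin d) → Y → ℝ)
        (ξs : EuclideanSpace ℝ (Fin d)) (g p : EuclideanSpace ℝ (Fin d) → ℝ),
      MomentPrior.IsRegularModel μ q Ξ f ξs →
      MomentPrior.IsRegularMomentPrior Ξ g p →
      (¬ MomentPrior.MemModel μ q Ξ f →
        MomentPrior.IsBigOp P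
          (fun n ω =>
            Real.log (MomentPrior.marginalLik Ξ f g p (MomentPrior.sample y n ω) /
                MomentPrior.jointDensity q (MomentPrior.sample y n ω))
              - (-((n : ℝ) * (MomentPrior.klModel μ q Ξ f).toReal)))
          (fun n => (n : ℝ) ^ (1 / 2 : ℝ))) ∧
      (MomentPrior.MemModel μ q Ξ f →
        MomentPrior.IsBigOp P
          (fun n ω =>
            Real.log (MomentPrior.marginalLik Ξ f g p (MomentPrior.sample y n ω) /
                MomentPrior.jointDensity q (MomentPrior.sample y n ω))
              - (-((d : ℝ) / 2 * Real.log n)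
                - (MomentPrior.momentOrder g ξs : ℝ) * Real.log n))
          (fun _ => 1))) ∧
    -- singleton models
    (∀ f : Y → ℝ, MomentPrior.IsRegularSingleton μ q f →
      (¬ f =ᵐ[μ] q →
        MomentPrior.IsBigOp P
          (fun n ω =>
            Real.log (MomentPrior.jointDensity f (MomentPrior.sample y n ω) /
                MomentPrior.jointDensity q (MomentPrior.sample y n ω))
              - (-((n : ℝ) * (MomentPrior.kl μ q f).toReal)))
          (fun n => (n : ℝ) ^ (1 / 2 : ℝ))) ∧
      (f =ᵐ[μ] q →
        MomentPrior.IsBigOp P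
          (fun n ω =>
            Real.log (MomentPrior.jointDensity f (MomentPrior.sample y n ω) /
                MomentPrior.jointDensity q (MomentPrior.sample y n ω)))
          (fun _ => 1))) := by
  refine ⟨fun d Ξ f ξs g p hM hgp => ⟨fun _ => hM.isBigOp_log_marginalLik_sqrt hq hy hgp,
    fun hmem => hM.isBigOp_log_marginalLik_one hq hy hgp hmem⟩, fun f hf => ⟨fun _ =>
    hy.isBigOp_log_jointDensity hq hf.density
      (MomentPrior.memLp_two_log_ratio hq hf.density hf.var_lt_top), fun h ε hε => ⟨0, ?_⟩⟩⟩
  refine Eventually.of_forall fun n => le_of_eq_of_le ?_ zero_le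
  rw [measure_eq_zero_iff_ae_notMem]
  filter_upwards [hy.ae_log_jointDensity_div_eq_zero hq.pos h] with ω h0 hω
  rw [h0 n, abs_zero, zero_mul] at hω
  exact lt_irrefl _ hω
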